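/- Let $F$ be a field of characteristic different from $2$, let $D$ be a (finite-dimensional) central division $F$-algebra and let $\rho$ be an involution of the first kind ($F$-linear involution) on $D$. Let $(V_1,h_1)$ be a finite-dimensional anisotropic hermitian space and $(V_2,h_2)$ a finite-dimensional anisotropic skew-hermitian space over $(D,\rho)$ (right $D$-vector spaces; $h_i(xa,yb)=\rho(a)h_i(x,y)b$). Let $\hat K=F((t))$, $\hat F=F((t^2))\subset\hat K$, let $\iota$ be the nontrivial $\hat F$-automorphism $f(t)\mapsto f(-t)$ of $\hat K$, and put $(\hat D,\hat\rho)=(D,\rho)\otimes_F(\hat K,\iota)$, $\hat V_i=V_i\otimes_F\hat K$, with $\hat h_i$ the form on $\hat V_i$ over $(\hat D,\hat\rho)$ extending $h_i$. Set $$\hat U=\hat V_1\oplus\hat V_2,\qquad \hat h=\hat h_1\perp\langle t\rangle\hat h_2,$$ a hermitian form over $(\hat D,\hat\rho)$, and let $\hat h^\iota(x,y)=\iota_{\hat D}\bigl(\hat h(\iota_{\hat U}(x),\iota_{\hat U}(y))\bigr)$, where $\iota_{\hat D}=\mathrm{Id}_D\otimes\iota$ and $\iota_{\hat U}=\mathrm{Id}_{V_1\oplus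 V_2}\otimes\iota$. A similitude $(\hat U,\hat h)\to(\hat U,\hat h^\iota)$ with multiplier $\mu\in\hat F^\times$ is a map $g\in\mathrm{End}_{\hat D}\hat U$ such that $\hat h^\iota(g(x),g(y))=\mu\,\hat h(x,y)$ for all $x,y\in\hat U$. (1) Every similitude $g\colon(\hat U,\hat h)\to(\hat U,\hat h^\iota)$ has the form $g=\lambda g'$ for some $\lambda\in\hat K^\times$ and some similitude $g'\colon(\hat U,\hat h)\to(\hat U,\hat h^\iota)$ with a multiplier $a\in F^\times$. (2) Let $v$ be the extension to $\hat D$ of the $t$-adic valuation, with $v(\sum_n d_n\otimes t^n)=\min\{n\mid d_n\neq0\}$. Then $\nu(x)=\frac12 v(\hat h(x,x))$ is a $v$-norm on $\hat U$, i.e., $\nu(x)=\infty$ only for $x=0$, $\nu(x+y)\ge\min(\nu(x),\nu(y))$, $\nu(xd)=\nu(x)+v(d)$, and $\hat U$ has a base $(e_i)$ with $\nu(\sum e_id_i)=\min_i(\nu(e_i)+v(d_i))$. Let $\mathrm{gr}(\hat U)=\bigoplus_{\gamma\in\mathbb Q}\hat U_{\ge\gamma}/\hat U_{>\gamma}$ be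 the associated graded module over the graded ring $\mathrm{gr}(\hat D)$ of $v$; write $\tilde x$ for the image of $x$ in degree $\nu(x)$ (respectively $v(x)$), with $\tilde 0=0$. Then $d\otimes\tilde t^{\,n}\mapsto(d\otimes t^n)^{\sim}$ and $x_i\otimes\tilde t^{\,n}\mapsto(x_i\otimes t^n)^{\sim}$ for $x_i\in V_i$ define a ring isomorphism and a compatible module isomorphism $$D\otimes_FF[\tilde t,\tilde t^{-1}]\simeq\mathrm{gr}(\hat D),\qquad (V_1\otimes_FF[\tilde t,\tilde t^{-1}])\oplus(V_2\otimes_FF[\tilde t,\tilde t^{-1}])\simeq\mathrm{gr}(\hat U).$$ Every similitude $g'\colon(\hat U,\hat h)\to(\hat U,\hat h^\iota)$ with multiplier $a\in F^\times$ satisfies $\nu(g'(x))=\nu(x)$ for all $x$, and the induced map $\tilde g'$ on $\mathrm{gr}(\hat U)$, given by $\tilde g'(\tilde x)=\widetilde{g'(x)}$, is, under this identification, of the form $\tilde g'=(g_1\otimes\mathrm{Id})\oplus(g_2\otimes\mathrm{Id})$, where $g_1\in\mathrm{End}_DV_1$ is a similitude of $h_1$ with multiplier $a$ and $g_2\in\mathrm{End}_DV_2$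 is a similitude of $h_2$ with multiplier $-a$; i.e., $\mu(g')=\mu(g_1)=-\mu(g_2)=a$. -/

import Mathlib

open scoped TensorProduct
open MulOpposite

namespace GenHerm

section ScalarExtension

/-- An `F`-linear involution on an `F`-algebra `A`: an anti-automorphism of order at most `2`
fixing `F`.  When `A` is central over `F` this is an involution of the first kind. -/
structure Involution (F A : Type*) [CommRing F] [Ring A] [Algebra F A] where
  toLinearMap : A →ₗ[F] A
  map_mul' : ∀ a b, toLinearMap (a * b) = toLinearMap b * toLinearMap a
  involutive' : ∀ a, toLinearMap (toLinearMap a) = a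

/-- The scalar extension `V ⊗_F B` of an `F`-module `V` to a commutative `F`-algebra `B`. -/
def ScalarExt (F V B : Type*) [CommRing F] [AddCommGroup V] [Module F V] [CommRing B]
    [Algebra F B] : Type _ := V ⊗[F] B

variable {F A B V W : Type*} [CommRing F] [Ring A] [Algebra F A] [CommRing B] [Algebra F B]
  [AddCommGroup V] [Module F V] [AddCommGroup W] [Module F W]

noncomputable instance : AddCommGroup (ScalarExt F V B) :=
  inferInstanceAs (AddCommGroup (V ⊗[F] B))

noncomputable instance : Module F (ScalarExt F V B) :=
  inferInstanceAs (Module F (V ⊗[F] B))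

/-- The pure tensor `x ⊗ b`. -/
noncomputable def ext (x : V) (b : B) : ScalarExt F V B := (x ⊗ₜ[F] b : V ⊗[F] B)

/-- The action of `(A ⊗ B)ᵐᵒᵖ` on `V ⊗ B` for a right `A`-module `V`. -/
noncomputable def extAction (F A B V : Type*) [CommRing F] [Ring A] [Algebra F A] [CommRing B]
    [Algebra F B] [AddCommGroup V] [Module F V] [Module Aᵐᵒᵖ V] [IsScalarTower F Aᵐᵒᵖ V] :
    (A ⊗[F] B)ᵐᵒᵖ →ₐ[F] Module.End F (V ⊗[F] B) :=
  ((Module.endTensorEndAlgHom (R := F) (S := F) (A := F) (M := V) (N := B)).comp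
    (Algebra.TensorProduct.map (Algebra.lsmul F F V : Aᵐᵒᵖ →ₐ[F] Module.End F V)
      (Algebra.lsmul F F B : Bᵐᵒᵖ →ₐ[F] Module.End F B))).comp
    (Algebra.TensorProduct.opAlgEquiv F F A B).symm.toAlgHom

/-- If `V` is a right `A`-module, then `V ⊗ B` is a right `A ⊗ B`-module. -/
noncomputable instance [Module Aᵐᵒᵖ V] [IsScalarTower F Aᵐᵒᵖ V] :
    Module (A ⊗[F] B)ᵐᵒᵖ (ScalarExt F V B) :=
  Module.compHom (V ⊗[F] B) (extAction F A B V).toRingHom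

theorem ext_smul [Module Aᵐᵒᵖ V] [IsScalarTower F Aᵐᵒᵖ V] (x : V) (b : B) (a : A) (c : B) :
    op (a ⊗ₜ[F] c) • (ext x b : ScalarExt F V B) = ext (op a • x) (b * c) := by
  change extAction F A B V (op (a ⊗ₜ[F] c)) (x ⊗ₜ b) = _
  simp only [extAction, ext, AlgHom.comp_apply]
  erw [show (Algebra.TensorProduct.opAlgEquiv F F A B).symm (op (a ⊗ₜ[F] c)) =
    op a ⊗ₜ[F] op c by simp]
  rw [Algebra.TensorProduct.map_tmul, Module.endTensorEndAlgHom_apply]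
  rfl

@[elab_as_elim]
theorem ScalarExt.induction_on {p : ScalarExt F V B → Prop} (z : ScalarExt F V B)
    (zero : p 0) (tmul : ∀ x b, p (ext x b)) (add : ∀ x y, p x → p y → p (x + y)) : p z :=
  TensorProduct.induction_on (motive := p) z zero tmul add

/-- `f ⊗ u` for `F`-linear maps `f` of `V` and `u` of `B`. -/
noncomputable def extMap (f : V →ₗ[F] W) (u : B →ₗ[F] B) :
    ScalarExt F V B →ₗ[F] ScalarExt F W B :=
  (TensorProduct.map f u : V ⊗[F] B →ₗ[F] W ⊗[F] B)

@[simp] theorem extMap_ext (f : V →ₗ[F] W) (u : B →ₗ[F] B) (x : V) (b : B) :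
    extMap f u (ext x b) = ext (f x) (u b) := rfl

/-- The involution `σ ⊗ ι` on `A ⊗ B`. -/
noncomputable def Involution.tensor (σ : Involution F A) (ι : B →ₐ[F] B)
    (hι : ∀ b, ι (ι b) = b) : Involution F (A ⊗[F] B) where
  toLinearMap := TensorProduct.map σ.toLinearMap ι.toLinearMap
  map_mul' x y := by
    induction x using TensorProduct.induction_on with
    | zero => simp
    | add x x' h h' => simp [add_mul, mul_add, h, h']
    | tmul a b =>
      induction y using TensorProduct.induction_on with
      | zero => simp
      | add y y' h h' => simp [add_mul, mul_add, h, h']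
      | tmul a' b' => simp [σ.map_mul', mul_comm]
  involutive' x := by
    induction x using TensorProduct.induction_on with
    | zero => simp
    | add x x' h h' => simp [h, h']
    | tmul a b => simp [σ.involutive', hι]

/-- A `δ`-hermitian form (`δ = ±1`) on the right `A`-module `V` with respect to the involution
`σ`: a biadditive map with `h (x a, y b) = σ(a) h(x, y) b` and `h (y, x) = δ σ(h (x, y))`. -/
structure HermForm (σ : Involution F A) (δ : ℤˣ) (V : Type*) [AddCommGroup V] [Module F V]
    [Module Aᵐᵒᵖ V] where
  bilin : V →ₗ[F] V →ₗ[F] A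
  smul_left : ∀ (a : A) (x y : V), bilin (op a • x) y = σ.toLinearMap a * bilin x y
  smul_right : ∀ (a : A) (x y : V), bilin x (op a • y) = bilin x y * a
  symm : ∀ x y : V, bilin y x = (δ : ℤ) • σ.toLinearMap (bilin x y)

namespace HermForm

variable {σ : Involution F A} {δ : ℤˣ}

/-- `h` is anisotropic if `h(x, x) = 0` only for `x = 0`. -/
def Anisotropic [Module Aᵐᵒᵖ V] (h : HermForm σ δ V) : Prop := ∀ x, h.bilin x x = 0 → x = 0

/-- Orthogonal sum of two forms. -/
def orthogonalSum [Module Aᵐᵒᵖ V] [Module Aᵐᵒᵖ W] (h : HermForm σ δ V) (k : HermForm σ δ W) :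
    HermForm σ δ (V × W) where
  bilin := h.bilin.compl₁₂ (LinearMap.fst F V W) (LinearMap.fst F V W) +
    k.bilin.compl₁₂ (LinearMap.snd F V W) (LinearMap.snd F V W)
  smul_left a x y := by simp [h.smul_left, k.smul_left, mul_add]
  smul_right a x y := by simp [h.smul_right, k.smul_right, add_mul]
  symm x y := by simp [h.symm x.1 y.1, k.symm x.2 y.2]

/-- The form `⟨c⟩h : (x, y) ↦ c h(x, y)`, for a central element `c` with `σ(c) = ε c`; it is
`εδ`-hermitian if `h` is `δ`-hermitian. -/
def scale [Module Aᵐᵒᵖ V] (h : HermForm σ δ V) (c : A) (hc : ∀ a, c * a = a * c) (ε δ' : ℤˣ)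
    (hε : σ.toLinearMap c = (ε : ℤ) • c) (hδ : δ' = ε * δ) : HermForm σ δ' V where
  bilin := h.bilin.compr₂ (LinearMap.mulLeft F c)
  smul_left a x y := by simp [h.smul_left, ← mul_assoc, hc]
  smul_right a x y := by simp [h.smul_right, mul_assoc]
  symm x y := by
    have h1 : (ε : ℤ) * (ε : ℤ) = 1 := by
      rw [← Units.val_mul, Int.units_mul_self, Units.val_one]
    simp only [LinearMap.compr₂_apply, LinearMap.mulLeft_apply]
    rw [hδ, h.symm x y, σ.map_mul', hε, hc, mul_smul_comm, smul_smul, smul_mul_assoc,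
      Units.val_mul, mul_right_comm, h1, one_mul]

/-- The `F`-bilinear map `(x ⊗ b, y ⊗ c) ↦ h(x, y) ⊗ ι(b) c` on `V ⊗ B`. -/
noncomputable def tensorBilin (h : V →ₗ[F] V →ₗ[F] A) (ι : B →ₐ[F] B) :
    ScalarExt F V B →ₗ[F] ScalarExt F V B →ₗ[F] A ⊗[F] B :=
  (TensorProduct.map₂ h ((LinearMap.mul F B).comp ι.toLinearMap) :
    V ⊗[F] B →ₗ[F] V ⊗[F] B →ₗ[F] A ⊗[F] B)

theorem tensorBilin_ext (h : V →ₗ[F] V →ₗ[F] A) (ι : B →ₐ[F] B) (x y : V) (b c : B) :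
    tensorBilin h ι (ext x b) (ext y c) = h x y ⊗ₜ[F] (ι b * c) := rfl

/-- The form `h ⊗ ι` on `V ⊗ B` over `(A ⊗ B, σ ⊗ ι)`:
`(x ⊗ b, y ⊗ c) ↦ h(x, y) ⊗ ι(b) c`. -/
noncomputable def tensor [Module Aᵐᵒᵖ V] [IsScalarTower F Aᵐᵒᵖ V] (h : HermForm σ δ V)
    (ι : B →ₐ[F] B) (hι : ∀ b, ι (ι b) = b) :
    HermForm (σ.tensor ι hι) δ (ScalarExt F V B) where
  bilin := tensorBilin h.bilin ι
  smul_left a x y := by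
    induction x using ScalarExt.induction_on with
    | zero => simp
    | add x x' h h' => simp only [smul_add, map_add, LinearMap.add_apply, h, h', mul_add]
    | tmul x b =>
    induction y using ScalarExt.induction_on with
    | zero => simp
    | add y y' h h' => simp only [map_add, h, h', mul_add]
    | tmul y c =>
    induction a using TensorProduct.induction_on with
    | zero => simp
    | add a a' h h' => simp only [op_add, add_smul, map_add, LinearMap.add_apply, h, h', add_mul]
    | tmul a d =>
      rw [ext_smul]
      simp [tensorBilin_ext, Involution.tensor, h.smul_left, mul_comm, mul_left_comm]
  smul_right a x y := by
    induction x using ScalarExt.induction_on with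
    | zero => simp
    | add x x' h h' => simp only [map_add, LinearMap.add_apply, h, h', add_mul]
    | tmul x b =>
    induction y using ScalarExt.induction_on with
    | zero => simp
    | add y y' h h' => simp only [smul_add, map_add, h, h', add_mul]
    | tmul y c =>
    induction a using TensorProduct.induction_on with
    | zero => simp
    | add a a' h h' => simp only [op_add, add_smul, map_add, h, h', mul_add]
    | tmul a d =>
      rw [ext_smul]
      simp [tensorBilin_ext, h.smul_right, mul_assoc]
  symm x y := by
    induction x using ScalarExt.induction_on with
    | zero => simp
    | add x x' h h' => simp only [map_add, LinearMap.add_apply, h, h', smul_add]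
    | tmul x b =>
    induction y using ScalarExt.induction_on with
    | zero => simp
    | add y y' h h' => simp only [map_add, LinearMap.add_apply, h, h', smul_add]
    | tmul y c =>
      rw [tensorBilin_ext, tensorBilin_ext, h.symm x y]
      simp only [Involution.tensor, TensorProduct.map_tmul, AlgHom.toLinearMap_apply, map_mul, hι]
      rw [TensorProduct.smul_tmul', mul_comm]

end HermForm

/-- The `A`-linear map `g : V → W` satisfies `h'(g(x), g(y)) = m h(x, y)` for all `x`, `y`. -/
def HasMultiplier [Module Aᵐᵒᵖ V] [Module Aᵐᵒᵖ W] (h : V →ₗ[F] V →ₗ[F] A)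
    (h' : W →ₗ[F] W →ₗ[F] A) (g : V →ₗ[Aᵐᵒᵖ] W) (m : A) : Prop :=
  ∀ x y, h' (g x) (g y) = m * h x y

end ScalarExtension

section Laurent

variable (F : Type*) [Field F]

/-- `F((t))` as an `F`-algebra through constant series. -/
noncomputable instance laurentAlgebra : Algebra F (LaurentSeries F) := HahnSeries.instAlgebra

/-- The `n`-th coefficient of `f(-t)` is `(-1)ⁿ fₙ`. -/
noncomputable def negVar (f : LaurentSeries F) : LaurentSeries F where
  coeff n := (-1 : F) ^ n * f.coeff n
  isPWO_support' := f.isPWO_support.mono fun n hn => by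
    rw [Function.mem_support] at hn
    exact right_ne_zero_of_mul hn

variable {F} in
theorem support_negVar (f : LaurentSeries F) : (negVar F f).support = f.support := by
  ext n
  simp only [HahnSeries.mem_support, negVar]
  exact ⟨right_ne_zero_of_mul, fun h => mul_ne_zero (zpow_ne_zero _ (by simp)) h⟩

/-- The automorphism `ι : f(t) ↦ f(-t)` of `F((t))`. -/
noncomputable def laurentIota : LaurentSeries F →ₐ[F] LaurentSeries F where
  toFun := negVar F
  map_one' := by
    ext n
    by_cases hn : n = 0 <;> simp [negVar, HahnSeries.coeff_one, hn]
  map_zero' := by ext n; simp [negVar]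
  map_add' f g := by ext n; simp [negVar, mul_add]
  map_mul' f g := by
    ext n
    rw [HahnSeries.coeff_mul_left' f.isPWO_support (support_negVar f).le,
      ← Finset.sum_subset (s₁ := Finset.antidiagonal f.isPWO_support g.isPWO_support n)
        (fun _ h => by simpa [support_negVar] using h)
        (fun _ h h' => (h' (by simpa [support_negVar] using h)).elim)]
    simp only [negVar]
    rw [HahnSeries.coeff_mul, Finset.mul_sum]
    refine Finset.sum_congr rfl fun ij hij => ?_
    rw [← (Finset.mem_antidiagonal.1 hij).2.2, zpow_add₀ (by simp)]
    ring
  commutes' a := by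
    ext n
    change (-1 : F) ^ n * (HahnSeries.C a).coeff n = (HahnSeries.C a).coeff n
    by_cases hn : n = 0 <;> simp [HahnSeries.C_apply, hn]

variable {F} in
@[simp] theorem laurentIota_coeff (f : LaurentSeries F) (n : ℤ) :
    (laurentIota F f).coeff n = (-1 : F) ^ n * f.coeff n := rfl

theorem laurentIota_laurentIota (f : LaurentSeries F) : laurentIota F (laurentIota F f) = f := by
  ext n
  rw [laurentIota_coeff, laurentIota_coeff, ← mul_assoc, ← mul_zpow]
  simp

/-- The power `t ^ n` in `F((t))`. -/
noncomputable def tPow (n : ℤ) : LaurentSeries F := HahnSeries.single n 1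

theorem laurentIota_tPow_one : laurentIota F (tPow F 1) = -tPow F 1 := by
  ext n
  by_cases hn : n = 1 <;> simp [tPow, hn]

/-- The subfield `F((t²))` of `F((t))`: the image of `F((t))` under `f(t) ↦ f(t²)`. -/
noncomputable def laurentSq : IntermediateField F (LaurentSeries F) :=
  (HahnSeries.embDomainAlgHom (R := F) (A := F) (AddMonoidHom.mulLeft (2 : ℤ))
    (fun a b h => by simpa using h) (fun a b => by simp)).fieldRange

variable (D : Type*) [DivisionRing D] [Algebra F D]

/-- The embedding of `D` in `D((t))` as constant series. -/
noncomputable def constSeries : D →ₐ[F] HahnSeries ℤ D where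
  toRingHom := HahnSeries.C
  commutes' _ := rfl

/-- The embedding of `F((t))` in `D((t))`. -/
noncomputable def coeffSeries : LaurentSeries F →ₐ[F] HahnSeries ℤ D where
  toFun f := HahnSeries.map f (algebraMap F D : F →ₙ+* D)
  map_one' := HahnSeries.map_C (1 : F) (algebraMap F D) |>.trans (by simp)
  map_mul' f g := HahnSeries.map_mul (algebraMap F D : F →ₙ+* D)
  map_zero' := by ext n; simp
  map_add' f g := by ext n; simp
  commutes' a := HahnSeries.map_C a (algebraMap F D)

theorem constSeries_mul_coeff (d : D) (x : HahnSeries ℤ D) (n : ℤ) :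
    (constSeries F D d * x).coeff n = d * x.coeff n := HahnSeries.coeff_single_zero_mul

theorem mul_constSeries_coeff (d : D) (x : HahnSeries ℤ D) (n : ℤ) :
    (x * constSeries F D d).coeff n = x.coeff n * d := HahnSeries.coeff_mul_single_zero

theorem coeffSeries_coeff (f : LaurentSeries F) (n : ℤ) :
    (coeffSeries F D f).coeff n = algebraMap F D (f.coeff n) := rfl

theorem commute_const_coeff (d : D) (f : LaurentSeries F) :
    Commute (constSeries F D d) (coeffSeries F D f) := by
  ext n
  rw [constSeries_mul_coeff, mul_constSeries_coeff, coeffSeries_coeff, Algebra.commutes]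

/-- The ring homomorphism `D ⊗_F F((t)) → D((t))`, `d ⊗ f ↦ ∑ₙ (fₙ d) tⁿ`, which writes an element
of `D ⊗_F F((t))` as a series `∑ₙ dₙ tⁿ` with coefficients in `D`. -/
noncomputable def toSeries : D ⊗[F] LaurentSeries F →ₐ[F] HahnSeries ℤ D :=
  Algebra.TensorProduct.lift (constSeries F D) (coeffSeries F D) (commute_const_coeff F D)

theorem toSeries_tmul_coeff (d : D) (f : LaurentSeries F) (n : ℤ) :
    (toSeries F D (d ⊗ₜ f)).coeff n = f.coeff n • d := by
  rw [toSeries, Algebra.TensorProduct.lift_tmul, constSeries_mul_coeff, coeffSeries_coeff,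
    Algebra.smul_def, Algebra.commutes]

/-- The inclusion of `ℤ ∪ {∞}` in `ℚ ∪ {∞}`. -/
def intToRatTop : WithTop ℤ →+ WithTop ℚ where
  toFun := WithTop.map (fun n : ℤ => (n : ℚ))
  map_zero' := by simp [← WithTop.coe_zero]
  map_add' a b := by
    induction a using WithTop.recTopCoe <;> induction b using WithTop.recTopCoe <;>
      simp [← WithTop.coe_add]

theorem intToRatTop_mono : Monotone intToRatTop :=
  (Monotone.withTop_map fun _ _ h => Int.cast_le.2 h)

/-- The extension to `D ⊗_F F((t))` of the `t`-adic valuation: the valuation of `∑ₙ dₙ tⁿ` is the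
least `n` with `dₙ ≠ 0`.  Its values are in `ℤ ∪ {∞}`, seen in `ℚ ∪ {∞}`. -/
noncomputable def hatVal : AddValuation (D ⊗[F] LaurentSeries F) (WithTop ℚ) :=
  AddValuation.of (fun x => intToRatTop (toSeries F D x).orderTop)
    (by simp [intToRatTop])
    (by simp)
    (fun x y => by
      rw [map_add, ← intToRatTop_mono.map_min]
      exact intToRatTop_mono HahnSeries.min_orderTop_le_orderTop_add)
    (fun x y => by rw [map_mul, HahnSeries.orderTop_mul, map_add])

end Laurent

section Graded

/-- A filtration of the additive group `M` given by a function `w : M → ℚ ∪ {∞}` with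
`w(0) = ∞`, `w(-x) = w(x)` and `w(x + y) ≥ min(w(x), w(y))`. -/
structure ValueFn (M : Type*) [AddCommGroup M] where
  toFun : M → WithTop ℚ
  map_zero' : toFun 0 = ⊤
  map_neg' : ∀ x, toFun (-x) = toFun x
  min_le_add' : ∀ x y, min (toFun x) (toFun y) ≤ toFun (x + y)

namespace ValueFn

variable {M N P : Type*} [AddCommGroup M] [AddCommGroup N] [AddCommGroup P]

instance : CoeFun (ValueFn M) (fun _ => M → WithTop ℚ) := ⟨toFun⟩

/-- `M_{≥γ} = {x | w(x) ≥ γ}`. -/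
def ge (w : ValueFn M) (γ : ℚ) : AddSubgroup M where
  carrier := {x | (γ : WithTop ℚ) ≤ w x}
  zero_mem' := by simp [w.map_zero']
  add_mem' {x y} hx hy := (le_min hx hy).trans (w.min_le_add' x y)
  neg_mem' {x} hx := by simpa [w.map_neg'] using hx

/-- `M_{>γ} = {x | w(x) > γ}`. -/
def gt (w : ValueFn M) (γ : ℚ) : AddSubgroup M where
  carrier := {x | (γ : WithTop ℚ) < w x}
  zero_mem' := by simp [w.map_zero']
  add_mem' {x y} hx hy := (lt_min hx hy).trans_le (w.min_le_add' x y)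
  neg_mem' {x} hx := by simpa [w.map_neg'] using hx

/-- `M_γ = M_{≥γ} / M_{>γ}`. -/
abbrev Piece (w : ValueFn M) (γ : ℚ) : Type _ := w.ge γ ⧸ (w.gt γ).addSubgroupOf (w.ge γ)

/-- The associated graded group `gr(M) = ⨁_γ M_γ`. -/
abbrev Gr (w : ValueFn M) : Type _ := DirectSum ℚ w.Piece

/-- The homogeneous element `x + M_{>γ}` of degree `γ`, for `w(x) ≥ γ`. -/
noncomputable def cls (w : ValueFn M) (γ : ℚ) (x : M) (hx : (γ : WithTop ℚ) ≤ w x) : w.Gr :=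
  DirectSum.of w.Piece γ (QuotientAddGroup.mk (⟨x, hx⟩ : w.ge γ))

open Classical in
/-- `x̃ = x + M_{>w(x)}` in degree `w(x)`, and `0` if `w(x) = ∞`. -/
noncomputable def lead (w : ValueFn M) (x : M) : w.Gr :=
  if hx : w x = ⊤ then 0 else w.cls ((w x).untop hx) x (by simp)

theorem cls_congr (w : ValueFn M) {γ γ' : ℚ} {x x' : M} (hγ : γ = γ') (h : x = x')
    (hx : (γ : WithTop ℚ) ≤ w x) : w.cls γ x hx = w.cls γ' x' (hγ ▸ h ▸ hx) := by
  subst hγ h; rfl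

theorem Gr.induction_on {w : ValueFn M} {p : w.Gr → Prop} (z : w.Gr) (zero : p 0)
    (cls : ∀ γ x hx, p (w.cls γ x hx)) (add : ∀ x y, p x → p y → p (x + y)) : p z := by
  induction z using DirectSum.induction_on with
  | zero => exact zero
  | add x y hx hy => exact add x y hx hy
  | of γ x =>
    induction x using QuotientAddGroup.induction_on with
    | H x => exact cls γ x.1 x.2

theorem cls_add (w : ValueFn M) {γ : ℚ} {x y : M} (hx : (γ : WithTop ℚ) ≤ w x)
    (hy : (γ : WithTop ℚ) ≤ w y) :
    w.cls γ (x + y) ((w.ge γ).add_mem hx hy) = w.cls γ x hx + w.cls γ y hy := by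
  simp only [cls]; rw [← map_add]; rfl

theorem cls_eq_zero (w : ValueFn M) {γ : ℚ} {x : M} (hx : (γ : WithTop ℚ) ≤ w x)
    (h : (γ : WithTop ℚ) < w x) : w.cls γ x hx = 0 := by
  rw [cls, (QuotientAddGroup.eq_zero_iff _).2, map_zero]
  exact h

/-- The homomorphism from `gr(M)` given by compatible homomorphisms `f_γ` from the groups
`M_{≥γ}`. -/
noncomputable def grLift (w : ValueFn M) (f : ∀ γ, w.ge γ →+ N)
    (hf : ∀ γ (x : w.ge γ), (γ : WithTop ℚ) < w x → f γ x = 0) : w.Gr →+ N :=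
  DirectSum.toAddMonoid fun γ => QuotientAddGroup.lift _ (f γ) fun x hx => hf γ x hx

theorem grLift_cls (w : ValueFn M) (f : ∀ γ, w.ge γ →+ N)
    (hf : ∀ γ (x : w.ge γ), (γ : WithTop ℚ) < w x → f γ x = 0) {γ : ℚ} {x : M}
    (hx : (γ : WithTop ℚ) ≤ w x) : w.grLift f hf (w.cls γ x hx) = f γ ⟨x, hx⟩ := by
  rw [grLift, cls, DirectSum.toAddMonoid_of]; rfl

/-- Left factor `x` of degree `≥ γ` fixed: the map `y + N_{>δ} ↦ β(x, y) + P_{>γ+δ}`. -/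
noncomputable def grMulAux (wM : ValueFn M) (wN : ValueFn N) (wP : ValueFn P) (β : M →+ N →+ P)
    (h : ∀ x y, wM x + wN y ≤ wP (β x y)) (γ : ℚ) (x : wM.ge γ) : wN.Gr →+ wP.Gr :=
  wN.grLift (fun δ => AddMonoidHom.mk' (fun y : wN.ge δ => wP.cls (γ + δ) (β x y)
      (le_trans (by push_cast; exact add_le_add x.2 y.2) (h x y)))
      (fun y y' => by
        rw [← cls_add]
        exact cls_congr _ rfl (by simp) _))
    (fun δ y hy => cls_eq_zero _ _ (lt_of_lt_of_le (by
      push_cast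
      exact (WithTop.add_lt_add_of_le_of_lt WithTop.coe_ne_top x.2 hy)) (h x y)))

theorem grMulAux_cls (wM : ValueFn M) (wN : ValueFn N) (wP : ValueFn P) (β : M →+ N →+ P)
    (h : ∀ x y, wM x + wN y ≤ wP (β x y)) (γ : ℚ) (x : wM.ge γ) {δ : ℚ} {y : N}
    (hy : (δ : WithTop ℚ) ≤ wN y) :
    grMulAux wM wN wP β h γ x (wN.cls δ y hy) = wP.cls (γ + δ) (β x y)
      (le_trans (by push_cast; exact add_le_add x.2 hy) (h x y)) :=
  grLift_cls _ _ _ _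

/-- A biadditive map `β` with `w(β(x, y)) ≥ w(x) + w(y)` induces a biadditive map of the
associated graded groups, `(x + M_{>γ}, y + N_{>δ}) ↦ β(x, y) + P_{>γ+δ}`. -/
noncomputable def grMul (wM : ValueFn M) (wN : ValueFn N) (wP : ValueFn P) (β : M →+ N →+ P)
    (h : ∀ x y, wM x + wN y ≤ wP (β x y)) : wM.Gr →+ wN.Gr →+ wP.Gr :=
  wM.grLift (fun γ => AddMonoidHom.mk' (grMulAux wM wN wP β h γ) fun x x' => by
      refine AddMonoidHom.ext fun z => ?_
      induction z using Gr.induction_on with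
      | zero => simp
      | add y y' hy hy' => simp only [map_add, hy, hy']
      | cls δ y hy =>
        rw [AddMonoidHom.add_apply, grMulAux_cls, grMulAux_cls, grMulAux_cls, ← cls_add]
        exact cls_congr _ rfl (by simp) _)
    (fun γ x hx => by
      refine AddMonoidHom.ext fun z => ?_
      induction z using Gr.induction_on with
      | zero => simp
      | add y y' hy hy' => simp only [map_add, hy, hy']
      | cls δ y hy =>
        refine (grMulAux_cls wM wN wP β h γ x hy).trans ?_
        refine cls_eq_zero _ _ (lt_of_lt_of_le ?_ (h x y))
        push_cast
        exact WithTop.add_lt_add_of_lt_of_le WithTop.coe_ne_top hx hy)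

theorem grMul_cls (wM : ValueFn M) (wN : ValueFn N) (wP : ValueFn P) (β : M →+ N →+ P)
    (h : ∀ x y, wM x + wN y ≤ wP (β x y)) {γ δ : ℚ} {x : M} {y : N}
    (hx : (γ : WithTop ℚ) ≤ wM x) (hy : (δ : WithTop ℚ) ≤ wN y) :
    grMul wM wN wP β h (wM.cls γ x hx) (wN.cls δ y hy) = wP.cls (γ + δ) (β x y)
      (le_trans (by push_cast; exact add_le_add hx hy) (h x y)) := by
  exact (DFunLike.congr_fun (grLift_cls wM _ _ hx) _).trans (grMulAux_cls wM wN wP β h γ ⟨x, hx⟩ hy)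

/-- A homomorphism `g` with `w(g(x)) ≥ w(x)` induces the map `x + M_{>γ} ↦ g(x) + M_{>γ}`. -/
noncomputable def grMap (w : ValueFn M) (g : M →+ M) (hg : ∀ x, w x ≤ w (g x)) : w.Gr →+ w.Gr :=
  w.grLift (fun γ => AddMonoidHom.mk' (fun x : w.ge γ => w.cls γ (g x) (le_trans x.2 (hg x)))
      fun x y => by
        rw [← cls_add]
        exact cls_congr _ rfl (by simp) _)
    fun γ x hx => cls_eq_zero _ _ (lt_of_lt_of_le hx (hg x))

theorem grMap_cls (w : ValueFn M) (g : M →+ M) (hg : ∀ x, w x ≤ w (g x)) {γ : ℚ} {x : M}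
    (hx : (γ : WithTop ℚ) ≤ w x) : w.grMap g hg (w.cls γ x hx) =
      w.cls γ (g x) (le_trans hx (hg x)) := by
  exact grLift_cls _ _ _ _

end ValueFn

section GrRing

variable {A : Type*} [Ring A] (v : AddValuation A (WithTop ℚ))

/-- The filtration defined by a valuation. -/
def valueFn : ValueFn A where
  toFun := v
  map_zero' := v.map_zero
  map_neg' := v.map_neg
  min_le_add' := v.map_add

/-- The graded ring `gr(A)` associated to a valuation, with
`(a + A_{>γ}) (b + A_{>δ}) = ab + A_{>γ+δ}`. -/
def GrRing : Type _ := (valueFn v).Gr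

noncomputable instance : AddCommGroup (GrRing v) := inferInstanceAs (AddCommGroup (valueFn v).Gr)

/-- Multiplication of `gr(A)`. -/
noncomputable def grRingMul : GrRing v →+ GrRing v →+ GrRing v :=
  ValueFn.grMul (valueFn v) (valueFn v) (valueFn v) AddMonoidHom.mul fun x y => (v.map_mul x y).ge

/-- The homogeneous element `a + A_{>γ}` of degree `γ`, for `v(a) ≥ γ`. -/
noncomputable def GrRing.cls (γ : ℚ) (a : A) (ha : (γ : WithTop ℚ) ≤ v a) : GrRing v :=
  (valueFn v).cls γ a ha

variable {v} in
theorem GrRing.cls_congr {γ γ' : ℚ} {x x' : A} (hγ : γ = γ') (h : x = x')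
    (hx : (γ : WithTop ℚ) ≤ v x) : GrRing.cls v γ x hx = GrRing.cls v γ' x' (hγ ▸ h ▸ hx) :=
  ValueFn.cls_congr _ hγ h hx

noncomputable instance : Mul (GrRing v) := ⟨fun x y => grRingMul v x y⟩

noncomputable instance : One (GrRing v) :=
  ⟨GrRing.cls v 0 1 (by simp)⟩

variable {v} in
theorem GrRing.induction_on {p : GrRing v → Prop} (z : GrRing v) (zero : p 0)
    (cls : ∀ γ x hx, p (GrRing.cls v γ x hx)) (add : ∀ x y, p x → p y → p (x + y)) : p z :=
  ValueFn.Gr.induction_on z zero cls add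

theorem grRingMul_cls {γ δ : ℚ} {x y : A} (hx : (γ : WithTop ℚ) ≤ v x)
    (hy : (δ : WithTop ℚ) ≤ v y) :
    grRingMul v (GrRing.cls v γ x hx) (GrRing.cls v δ y hy) =
      GrRing.cls v (γ + δ) (x * y)
        (le_trans (by push_cast; exact add_le_add hx hy) (v.map_mul x y).ge) :=
  ValueFn.grMul_cls _ _ _ _ _ hx hy

noncomputable instance : Ring (GrRing v) :=
  { (inferInstance : AddCommGroup (GrRing v)), (inferInstance : Mul (GrRing v)),
    (inferInstance : One (GrRing v)) with
    left_distrib := fun x y z => map_add (grRingMul v x) y z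
    right_distrib := fun x y z => by
      change grRingMul v (x + y) z = grRingMul v x z + grRingMul v y z
      rw [map_add, AddMonoidHom.add_apply]
    zero_mul := fun x => by
      change grRingMul v 0 x = 0
      rw [map_zero, AddMonoidHom.zero_apply]
    mul_zero := fun x => map_zero (grRingMul v x)
    mul_assoc := fun x y z => by
      change grRingMul v (grRingMul v x y) z = grRingMul v x (grRingMul v y z)
      induction x using GrRing.induction_on with
      | zero => simp only [map_zero, AddMonoidHom.zero_apply]
      | add x x' h h' => simp only [map_add, AddMonoidHom.add_apply, h, h']
      | cls γ x hx =>
      induction y using GrRing.induction_on with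
      | zero => simp only [map_zero, AddMonoidHom.zero_apply]
      | add x x' h h' => simp only [map_add, AddMonoidHom.add_apply, h, h']
      | cls δ y hy =>
      induction z using GrRing.induction_on with
      | zero => simp only [map_zero]
      | add x x' h h' => simp only [map_add, h, h']
      | cls ε z hz =>
        rw [grRingMul_cls, grRingMul_cls, grRingMul_cls, grRingMul_cls]
        exact GrRing.cls_congr (add_assoc _ _ _) (mul_assoc _ _ _) _
    one_mul := fun x => by
      change grRingMul v (GrRing.cls v 0 1 _) x = x
      induction x using GrRing.induction_on with
      | zero => simp only [map_zero]
      | add x x' h h' => simp only [map_add, h, h']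
      | cls γ x hx =>
        rw [grRingMul_cls]
        exact GrRing.cls_congr (zero_add _) (one_mul _) _
    mul_one := fun x => by
      change grRingMul v x (GrRing.cls v 0 1 _) = x
      induction x using GrRing.induction_on with
      | zero => simp only [map_zero, AddMonoidHom.zero_apply]
      | add x x' h h' => simp only [map_add, AddMonoidHom.add_apply, h, h']
      | cls γ x hx =>
        rw [grRingMul_cls]
        exact GrRing.cls_congr (add_zero _) (mul_one _) _ }

/-- The element `ã` of `gr(A)` defined by `a ∈ A`. -/
noncomputable def GrRing.lead (a : A) : GrRing v := (valueFn v).lead a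

end GrRing

section GrModule

variable {A : Type*} [Ring A]

/-- A `v`-norm on the right `A`-module `M`: a map `ν : M → ℚ ∪ {∞}` such that `ν(x) = ∞` only for
`x = 0`, `ν(x + y) ≥ min(ν(x), ν(y))`, `ν(x a) = ν(x) + v(a)`, and such that there is a splitting
base, i.e., a base `(eᵢ)` of `M` with `ν(∑ eᵢ aᵢ) = minᵢ (ν(eᵢ) + v(aᵢ))`. -/
structure VNorm (v : AddValuation A (WithTop ℚ)) (M : Type*) [AddCommGroup M] [Module Aᵐᵒᵖ M] where
  toFun : M → WithTop ℚ
  eq_top_iff' : ∀ x, toFun x = ⊤ ↔ x = 0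
  min_le_add' : ∀ x y, min (toFun x) (toFun y) ≤ toFun (x + y)
  map_smul' : ∀ (a : A) (x : M), toFun (op a • x) = toFun x + v a
  exists_splitting' : ∃ (n : ℕ) (e : Module.Basis (Fin n) Aᵐᵒᵖ M), ∀ a : Fin n → A,
    toFun (∑ i, op (a i) • e i) = Finset.univ.inf fun i => toFun (e i) + v (a i)

variable {v : AddValuation A (WithTop ℚ)} {M : Type*} [AddCommGroup M] [Module Aᵐᵒᵖ M]

namespace VNorm

instance : CoeFun (VNorm v M) (fun _ => M → WithTop ℚ) := ⟨toFun⟩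

/-- The filtration defined by a norm. -/
def valueFn (ν : VNorm v M) : ValueFn M where
  toFun := ν
  map_zero' := (ν.eq_top_iff' 0).2 rfl
  map_neg' x := by
    have := ν.map_smul' (-1) x
    rwa [v.map_neg, v.map_one, add_zero, op_neg, op_one, neg_one_smul] at this
  min_le_add' := ν.min_le_add'

/-- The graded module `gr(M) = ⨁_γ M_{≥γ} / M_{>γ}` associated to a norm. -/
def Gr (ν : VNorm v M) : Type _ := ν.valueFn.Gr

noncomputable instance (ν : VNorm v M) : AddCommGroup ν.Gr :=
  inferInstanceAs (AddCommGroup ν.valueFn.Gr)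

/-- The homogeneous element `x + M_{>γ}` of degree `γ`, for `ν(x) ≥ γ`. -/
noncomputable def cls (ν : VNorm v M) (γ : ℚ) (x : M) (hx : (γ : WithTop ℚ) ≤ ν x) : ν.Gr :=
  ν.valueFn.cls γ x hx

theorem cls_congr (ν : VNorm v M) {γ γ' : ℚ} {x x' : M} (hγ : γ = γ') (h : x = x')
    (hx : (γ : WithTop ℚ) ≤ ν x) : ν.cls γ x hx = ν.cls γ' x' (hγ ▸ h ▸ hx) :=
  ValueFn.cls_congr _ hγ h hx

theorem Gr.induction_on {ν : VNorm v M} {p : ν.Gr → Prop} (z : ν.Gr) (zero : p 0)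
    (cls : ∀ γ x hx, p (ν.cls γ x hx)) (add : ∀ x y, p x → p y → p (x + y)) : p z :=
  ValueFn.Gr.induction_on z zero cls add

/-- The element `x̃ = x + M_{>ν(x)}` of `gr(M)` defined by `x ∈ M`. -/
noncomputable def lead (ν : VNorm v M) (x : M) : ν.Gr := ν.valueFn.lead x

/-- Right multiplication by elements of `gr(A)`:
`(x + M_{>γ}) (a + A_{>δ}) = x a + M_{>γ+δ}`. -/
noncomputable def grSMul (ν : VNorm v M) : ν.Gr →+ GrRing v →+ ν.Gr :=
  ValueFn.grMul ν.valueFn (GenHerm.valueFn v) ν.valueFn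
    (AddMonoidHom.mk' (fun x => AddMonoidHom.mk' (fun a : A => op a • x)
      fun a b => by rw [op_add, add_smul]) fun x y => by ext a; simp)
    fun x a => (ν.map_smul' a x).ge

theorem grSMul_cls (ν : VNorm v M) {γ δ : ℚ} {x : M} {a : A}
    (hx : (γ : WithTop ℚ) ≤ ν x) (ha : (δ : WithTop ℚ) ≤ v a) :
    ν.grSMul (ν.cls γ x hx) (GrRing.cls v δ a ha) =
      ν.cls (γ + δ) (op a • x)
        (le_trans (by push_cast; exact add_le_add hx ha) (ν.map_smul' a x).ge) :=
  ValueFn.grMul_cls _ _ _ _ _ hx ha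

theorem grSMul_one (ν : VNorm v M) (z : ν.Gr) : ν.grSMul z 1 = z := by
  change ν.grSMul z (GrRing.cls v 0 1 _) = z
  induction z using Gr.induction_on with
  | zero => simp only [map_zero, AddMonoidHom.zero_apply]
  | add x x' h h' => simp only [map_add, AddMonoidHom.add_apply, h, h']
  | cls γ x hx =>
    rw [grSMul_cls]
    exact ν.cls_congr (add_zero _) (by simp) _

theorem grSMul_mul (ν : VNorm v M) (z : ν.Gr) (a b : GrRing v) :
    ν.grSMul z (a * b) = ν.grSMul (ν.grSMul z a) b := by
  change ν.grSMul z (grRingMul v a b) = _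
  induction z using Gr.induction_on with
  | zero => simp only [map_zero, AddMonoidHom.zero_apply]
  | add x x' h h' => simp only [map_add, AddMonoidHom.add_apply, h, h']
  | cls γ x hx =>
  induction a using GrRing.induction_on with
  | zero => simp only [map_zero, AddMonoidHom.zero_apply]
  | add x x' h h' => simp only [map_add, AddMonoidHom.add_apply, h, h']
  | cls δ a ha =>
  induction b using GrRing.induction_on with
  | zero => simp only [map_zero]
  | add x x' h h' => simp only [map_add, h, h']
  | cls ε b hb =>
    rw [grRingMul_cls, grSMul_cls, grSMul_cls, grSMul_cls]
    exact ν.cls_congr (add_assoc _ _ _).symm (by rw [op_mul, mul_smul]) _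

/-- `gr(M)` is a right `gr(A)`-module. -/
noncomputable instance (ν : VNorm v M) : Module (GrRing v)ᵐᵒᵖ ν.Gr where
  smul a z := ν.grSMul z a.unop
  one_smul z := ν.grSMul_one z
  mul_smul a b z := ν.grSMul_mul z b.unop a.unop
  smul_zero a := by
    change ν.grSMul 0 a.unop = 0
    rw [map_zero, AddMonoidHom.zero_apply]
  smul_add a x y := by
    change ν.grSMul (x + y) a.unop = ν.grSMul x a.unop + ν.grSMul y a.unop
    rw [map_add, AddMonoidHom.add_apply]
  add_smul a b x := map_add (ν.grSMul x) a.unop b.unop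
  zero_smul x := map_zero (ν.grSMul x)

/-- The additive map underlying `grMap`. -/
noncomputable def grMapHom (ν : VNorm v M) (g : M →ₗ[Aᵐᵒᵖ] M) (hg : ∀ x, ν (g x) = ν x) :
    ν.Gr →+ ν.Gr :=
  ν.valueFn.grMap g.toAddMonoidHom fun x => (hg x).ge

theorem grMapHom_cls (ν : VNorm v M) (g : M →ₗ[Aᵐᵒᵖ] M) (hg : ∀ x, ν (g x) = ν x) {γ : ℚ} {x : M}
    (hx : (γ : WithTop ℚ) ≤ ν x) :
    ν.grMapHom g hg (ν.cls γ x hx) = ν.cls γ (g x) (le_of_le_of_eq hx (hg x).symm) :=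
  ValueFn.grMap_cls _ _ _ hx

/-- The homomorphism of graded modules `g̃` induced by an endomorphism `g` of `M` such that
`ν(g(x)) = ν(x)` for all `x`; it maps `x + M_{>γ}` to `g(x) + M_{>γ}`. -/
noncomputable def grMap (ν : VNorm v M) (g : M →ₗ[Aᵐᵒᵖ] M) (hg : ∀ x, ν (g x) = ν x) :
    ν.Gr →ₗ[(GrRing v)ᵐᵒᵖ] ν.Gr where
  toFun := ν.grMapHom g hg
  map_add' := map_add _
  map_smul' a z := by
    change ν.grMapHom g hg (ν.grSMul z a.unop) = ν.grSMul (ν.grMapHom g hg z) a.unop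
    induction z using Gr.induction_on with
    | zero => simp only [map_zero, AddMonoidHom.zero_apply]
    | add x x' h h' => simp only [map_add, AddMonoidHom.add_apply, h, h']
    | cls γ x hx =>
    induction a.unop using GrRing.induction_on with
    | zero => simp only [map_zero]
    | add x x' h h' => simp only [map_add, h, h']
    | cls δ a ha =>
      rw [grSMul_cls, grMapHom_cls, grMapHom_cls, grSMul_cls]
      exact ν.cls_congr rfl (by simp) _

theorem grMap_lead (ν : VNorm v M) (g : M →ₗ[Aᵐᵒᵖ] M) (hg : ∀ x, ν (g x) = ν x) (x : M) :
    ν.grMap g hg (ν.lead x) = ν.lead (g x) := by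
  change ν.grMapHom g hg (ν.valueFn.lead x) = ν.valueFn.lead (g x)
  have hg' : ν.valueFn (g x) = ν.valueFn x := hg x
  by_cases hx : ν.valueFn x = ⊤
  · rw [ValueFn.lead, dif_pos hx, ValueFn.lead, dif_pos (hg'.trans hx)]
    exact map_zero (ν.grMapHom g hg)
  · rw [ValueFn.lead, dif_neg hx, ValueFn.lead, dif_neg (fun h => hx (hg'.symm.trans h))]
    refine (ν.grMapHom_cls g hg _).trans ?_
    exact ν.cls_congr (by simp only [hg']) rfl _

end VNorm

end GrModule

end Graded

section GenericForm

variable {F D : Type*} [Field F] [DivisionRing D] [Algebra F D] (ρ : Involution F D)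

/-- The unitary involution `ρ ⊗ ι` on `D ⊗_F F((t))`. -/
noncomputable def hatInvolution : Involution F (D ⊗[F] LaurentSeries F) :=
  ρ.tensor (laurentIota F) (laurentIota_laurentIota F)

theorem one_tmul_comm (f : LaurentSeries F) (a : D ⊗[F] LaurentSeries F) :
    ((1 : D) ⊗ₜ[F] f) * a = a * ((1 : D) ⊗ₜ[F] f) := by
  induction a using TensorProduct.induction_on with
  | zero => simp
  | add a b ha hb => rw [mul_add, add_mul, ha, hb]
  | tmul d g => simp [mul_comm]

theorem Involution.map_one (σ : Involution F D) : σ.toLinearMap 1 = 1 := by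
  have h := σ.map_mul' (σ.toLinearMap 1) 1
  rwa [mul_one, σ.involutive', mul_one, eq_comm] at h

theorem hatInvolution_t :
    (hatInvolution ρ).toLinearMap ((1 : D) ⊗ₜ[F] tPow F 1) =
      ((-1 : ℤˣ) : ℤ) • ((1 : D) ⊗ₜ[F] tPow F 1) := by
  simp only [hatInvolution, Involution.tensor, TensorProduct.map_tmul, ρ.map_one,
    AlgHom.toLinearMap_apply, laurentIota_tPow_one, TensorProduct.tmul_neg]
  simp

/-- The automorphism `id ⊗ ι` of `D ⊗_F F((t))`. -/
noncomputable def iotaD (F D : Type*) [Field F] [DivisionRing D] [Algebra F D] :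
    D ⊗[F] LaurentSeries F →ₐ[F] D ⊗[F] LaurentSeries F :=
  Algebra.TensorProduct.map (AlgHom.id F D) (laurentIota F)

/-- `Û = (V₁ ⊗_F F((t))) ⊕ (V₂ ⊗_F F((t)))`. -/
abbrev HatU (F V₁ V₂ : Type*) [Field F] [AddCommGroup V₁] [Module F V₁] [AddCommGroup V₂]
    [Module F V₂] : Type _ :=
  ScalarExt F V₁ (LaurentSeries F) × ScalarExt F V₂ (LaurentSeries F)

/-- The map `id ⊗ ι` on `Û`. -/
noncomputable def iotaU (F V₁ V₂ : Type*) [Field F] [AddCommGroup V₁] [Module F V₁]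
    [AddCommGroup V₂] [Module F V₂] : HatU F V₁ V₂ →ₗ[F] HatU F V₁ V₂ :=
  (extMap LinearMap.id (laurentIota F).toLinearMap).prodMap
    (extMap LinearMap.id (laurentIota F).toLinearMap)

variable {ρ} {V₁ V₂ : Type*}
  [AddCommGroup V₁] [Module F V₁] [Module Dᵐᵒᵖ V₁] [IsScalarTower F Dᵐᵒᵖ V₁]
  [AddCommGroup V₂] [Module F V₂] [Module Dᵐᵒᵖ V₂] [IsScalarTower F Dᵐᵒᵖ V₂]

/-- The hermitian form `ĥ = ĥ₁ ⊥ ⟨t⟩ĥ₂` on `Û`, where `ĥᵢ` is the extension of `hᵢ`. -/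
noncomputable def hatForm (h₁ : HermForm ρ 1 V₁) (h₂ : HermForm ρ (-1) V₂) :
    HermForm (hatInvolution ρ) 1 (HatU F V₁ V₂) :=
  (h₁.tensor (laurentIota F) (laurentIota_laurentIota F)).orthogonalSum
    ((h₂.tensor (laurentIota F) (laurentIota_laurentIota F)).scale ((1 : D) ⊗ₜ[F] tPow F 1)
      (one_tmul_comm _) (-1) 1 (hatInvolution_t ρ) (by simp))

/-- The conjugate form `ĥ^ι : (x, y) ↦ ι(ĥ(ι(x), ι(y)))`. -/
noncomputable def conjForm (h₁ : HermForm ρ 1 V₁) (h₂ : HermForm ρ (-1) V₂) :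
    HatU F V₁ V₂ →ₗ[F] HatU F V₁ V₂ →ₗ[F] D ⊗[F] LaurentSeries F :=
  ((hatForm h₁ h₂).bilin.compl₁₂ (iotaU F V₁ V₂) (iotaU F V₁ V₂)).compr₂ (iotaD F D).toLinearMap

/-- `ĥ^ι(g(x), g(y)) = m ĥ(x, y)` for all `x`, `y`, where `m` is an element of `F((t))`. -/
def HasHatMultiplier (h₁ : HermForm ρ 1 V₁) (h₂ : HermForm ρ (-1) V₂)
    (g : HatU F V₁ V₂ →ₗ[(D ⊗[F] LaurentSeries F)ᵐᵒᵖ] HatU F V₁ V₂) (m : LaurentSeries F) : Prop :=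
  HasMultiplier (hatForm h₁ h₂).bilin (conjForm h₁ h₂) g ((1 : D) ⊗ₜ[F] m)

/-- `g` is a similitude `(Û, ĥ) → (Û, ĥ^ι)`: it has a multiplier in `F((t²))ˣ`. -/
def IsHatSimilitude (h₁ : HermForm ρ 1 V₁) (h₂ : HermForm ρ (-1) V₂)
    (g : HatU F V₁ V₂ →ₗ[(D ⊗[F] LaurentSeries F)ᵐᵒᵖ] HatU F V₁ V₂) : Prop :=
  ∃ m ∈ laurentSq F, m ≠ 0 ∧ HasHatMultiplier h₁ h₂ g m

end GenericForm

end GenHerm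

open GenHerm
open scoped TensorProduct LaurentPolynomial

/-! Everything is read off from lowest-order coefficients. An element of `V ⊗ F((t))` is viewed as a
series with coefficients in `V`. The coefficient of `t^(m+k)` in `ĥᵢ(z, w)`, for `z`, `w` of order
at least `m`, `k`, is `(-1)^m hᵢ(z_m, w_k)`, the sign coming from `ι` on the left argument
(`HermForm.hat_lowest`). Since `hᵢ` is anisotropic, `ĥᵢ(z, z)` has order exactly `2 ord z`. Hence
the two summands of `ĥ(x, x)` have even and odd valuations respectively, cannot cancel, and `½
v(ĥ(x, x)) = min(ord x₁, ord x₂ + 1/2)` (`half_hatVal_hatForm`). The norm axioms, a splitting base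
and the graded module follow from this formula: `V₁ ⊗ tⁿ` sits in degree `n`, `V₂ ⊗ tⁿ` in degree `n
+ 1/2`, and all other degrees vanish.

For the rescaling of similitudes, write a multiplier as `f(t²)` with `f = b t^k g²`, where `b` is
the leading coefficient and `g` is a power series; the square root exists because 2 is invertible.
With `c = t^k g(t²)` one has `ι(c) = (-1)^k c`, so that `f(t²) = (-1)^k b ι(c) c`
(`exists_eq_norm`). Multiplying an argument pair by `c` multiplies `ĥ^ι` by `ι(c) c`, so dividing
the similitude by `c` leaves the constant multiplier `(-1)^k b`.

A similitude with constant multiplier `a` preserves the norm because `ι` preserves valuations and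
`v(a) = 0`. It therefore acts on the pieces of degree `0` and `1/2`, giving `g₁` and `g₂`. Comparing
coefficients of `t⁰` in the similitude identity gives multiplier `a` for `g₁`. For `g₂` the
coefficient of `t¹` is compared, and there `ι` contributes the sign `-1`, whence the multiplier
`-a`. The other degrees are translates by powers of `t`, with which the similitude commutes
(`grMap_eq`). -/

namespace GenHerm

/-! ### Tensors as series, their order and lowest coefficients -/

section Series

variable {F V W P : Type*} [Field F] [AddCommGroup V] [Module F V] [AddCommGroup W] [Module F W]
  [AddCommGroup P] [Module F P]

/-- The map `V ⊗ F((t)) → V((t))`, `x ⊗ f ↦ ∑ₙ (fₙ x) tⁿ`. -/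
noncomputable def series (F V : Type*) [Field F] [AddCommGroup V] [Module F V] :
    ScalarExt F V (LaurentSeries F) →ₗ[F] HahnSeries ℤ V :=
  (TensorProduct.lift (LinearMap.mk₂ F
    (fun (x : V) (f : LaurentSeries F) => f.map (LinearMap.toSpanSingleton F V x))
    (fun x y f => by ext n; simp) (fun a x f => by ext n; simp [smul_comm a])
    (fun x f g => by ext n; simp [add_smul]) (fun a x f => by ext n; simp)) :
    V ⊗[F] LaurentSeries F →ₗ[F] HahnSeries ℤ V)

@[simp] theorem series_ext_coeff (x : V) (f : LaurentSeries F) (n : ℤ) :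
    (series F V (ext x f)).coeff n = f.coeff n • x := rfl

/-- The coefficient of `tⁿ`. -/
noncomputable def coeffAt (n : ℤ) : ScalarExt F V (LaurentSeries F) →ₗ[F] V where
  toFun z := (series F V z).coeff n
  map_add' x y := by simp
  map_smul' a x := by simp

@[simp] theorem coeffAt_ext (n : ℤ) (x : V) (f : LaurentSeries F) :
    coeffAt n (ext x f) = f.coeff n • x := series_ext_coeff x f n

/-- The order of an element of `V ⊗ F((t))` as a series with coefficients in `V`. -/
noncomputable def ord (z : ScalarExt F V (LaurentSeries F)) : WithTop ℤ := (series F V z).orderTop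

theorem le_ord_iff {m : WithTop ℤ} {z : ScalarExt F V (LaurentSeries F)} :
    m ≤ ord z ↔ ∀ n : ℤ, n < m → coeffAt n z = 0 := HahnSeries.le_orderTop_iff_forall

theorem coeffAt_eq_zero {n : ℤ} {z : ScalarExt F V (LaurentSeries F)} (h : n < ord z) :
    coeffAt n z = 0 := le_ord_iff.1 le_rfl n h

theorem ord_eq_iff {n : ℤ} {z : ScalarExt F V (LaurentSeries F)} :
    ord z = n ↔ n ≤ ord z ∧ coeffAt n z ≠ 0 := by
  refine ⟨fun h => ⟨h.ge, HahnSeries.coeff_orderTop_ne h⟩, fun ⟨h, h'⟩ => le_antisymm ?_ h⟩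
  exact HahnSeries.orderTop_le_of_coeff_ne_zero h'

theorem lt_ord_iff {n : ℤ} {z : ScalarExt F V (LaurentSeries F)} (h : n ≤ ord z) :
    n < ord z ↔ coeffAt n z = 0 :=
  ⟨coeffAt_eq_zero, fun h' => lt_of_le_of_ne h fun h'' => (ord_eq_iff.1 h''.symm).2 h'⟩

theorem min_ord_le_ord_add (x y : ScalarExt F V (LaurentSeries F)) :
    min (ord x) (ord y) ≤ ord (x + y) := by
  rw [ord, ord, ord, map_add]
  exact HahnSeries.min_orderTop_le_orderTop_add

theorem le_ord_ext (x : V) (f : LaurentSeries F) : f.orderTop ≤ ord (ext x f) :=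
  le_ord_iff.2 fun n hn => by
    rw [coeffAt_ext, HahnSeries.coeff_eq_zero_of_lt_orderTop hn, zero_smul]

theorem le_ord_ext_tPow (x : V) (n : ℤ) : (n : WithTop ℤ) ≤ ord (ext x (tPow F n)) :=
  HahnSeries.orderTop_single_le.trans (le_ord_ext _ _)

theorem coeffAt_ext_tPow (x : V) (n : ℤ) : coeffAt n (ext x (tPow F n)) = x := by
  simp [tPow]

/-- Removing the leading monomial raises the order. This is what makes a class in a graded piece
depend only on the leading coefficient. -/
theorem lt_ord_sub_ext {n : ℤ} {z : ScalarExt F V (LaurentSeries F)} (hz : n ≤ ord z) :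
    n < ord (z - ext (coeffAt n z) (tPow F n)) := by
  rw [lt_ord_iff, map_sub, coeffAt_ext_tPow, sub_self]
  rw [le_ord_iff] at hz ⊢
  intro k hk
  rw [map_sub, hz k hk, le_ord_iff.1 (le_ord_ext_tPow (F := F) (coeffAt n z) n) k hk, sub_zero]

/-- In terms of a base of `V`, the elements of `V ⊗ F((t))` of order at least `m` are the sums of
pure tensors `x ⊗ f` with `f` of order at least `m`. -/
@[elab_as_elim]
theorem ord_induction {m : WithTop ℤ} {p : ScalarExt F V (LaurentSeries F) → Prop}
    (z : ScalarExt F V (LaurentSeries F)) (hz : m ≤ ord z) (zero : p 0)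
    (tmul : ∀ x f, m ≤ HahnSeries.orderTop f → p (ext x f))
    (add : ∀ x y, p x → p y → p (x + y)) : p z := by
  classical
  let b := Module.Basis.ofVectorSpace F V
  let s : ScalarExt F V (LaurentSeries F) ≃ₗ[F] _ →₀ LaurentSeries F :=
    TensorProduct.equivFinsuppOfBasisLeft b
  have hs : ∀ x f i, s (ext x f) i = b.repr x i • f :=
    TensorProduct.equivFinsuppOfBasisLeft_apply_tmul_apply b
  -- Taking coordinates in `V` commutes with taking the coefficient of `tⁿ`, so a lower bound on the
  -- order of `z` is inherited by each of its finitely many nonzero coordinate series.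
  have key : ∀ w i n, (s w i).coeff n = b.repr (coeffAt n w) i := by
    intro w i n
    induction w using ScalarExt.induction_on with
    | zero => simp
    | tmul x f => simp [hs, mul_comm]
    | add x y hx hy => simp [hx, hy]
  have hsum : z = ∑ i ∈ (s z).support, ext (b i) (s z i) := by
    conv_lhs => rw [← s.symm_apply_apply z]
    exact TensorProduct.equivFinsuppOfBasisLeft_symm_apply b (s z)
  rw [hsum]
  refine Finset.sum_induction _ p add zero fun i _ => tmul _ _ ?_
  rw [HahnSeries.le_orderTop_iff_forall]
  intro n hn
  rw [key, le_ord_iff.1 hz n hn, map_zero, Finsupp.zero_apply]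

theorem zero_ext (f : LaurentSeries F) : (ext 0 f : ScalarExt F V (LaurentSeries F)) = 0 :=
  TensorProduct.zero_tmul _ _

theorem add_ext (x y : V) (f : LaurentSeries F) :
    (ext (x + y) f : ScalarExt F V (LaurentSeries F)) = ext x f + ext y f :=
  TensorProduct.add_tmul _ _ _

/-- This is the injectivity of `V ⊗ F((t)) → V((t))`. It is `ord_induction` at the threshold `⊤`,
where only the pure tensors `x ⊗ 0` remain. -/
theorem ord_eq_top_iff {z : ScalarExt F V (LaurentSeries F)} : ord z = ⊤ ↔ z = 0 := by
  refine ⟨fun h => ?_, fun h => by simp [h, ord]⟩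
  refine ord_induction (p := fun z => z = 0) z h.ge rfl (fun x f hf => ?_)
    (fun x y hx hy => by rw [hx, hy, add_zero])
  rw [top_le_iff, HahnSeries.orderTop_eq_top] at hf
  rw [hf]
  exact TensorProduct.tmul_zero _ _

/-- A pair of exponents `i ≥ m`, `j ≥ k` with `i + j = m + k` can only be `(m, k)`. -/
theorem mul_coeff_add {f g : LaurentSeries F} {m k : ℤ} (hf : m ≤ f.orderTop)
    (hg : k ≤ g.orderTop) : (f * g).coeff (m + k) = f.coeff m * g.coeff k := by
  rw [HahnSeries.coeff_mul, Finset.sum_eq_single (m, k)]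
  · rintro ⟨i, j⟩ hij hne
    rw [Finset.mem_antidiagonal] at hij
    obtain ⟨hi, hj, hij⟩ := hij
    have h1 : m ≤ i := by
      exact_mod_cast hf.trans (HahnSeries.orderTop_le_of_coeff_ne_zero hi)
    have h2 : k ≤ j := by
      exact_mod_cast hg.trans (HahnSeries.orderTop_le_of_coeff_ne_zero hj)
    simp only at hij
    exact (hne (Prod.ext (by simp only; omega) (by simp only; omega))).elim
  · intro h
    by_contra h'
    exact h (Finset.mem_antidiagonal.2 ⟨left_ne_zero_of_mul h', right_ne_zero_of_mul h', rfl⟩)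

/-- Lowest terms of products. -/
theorem lowest_coeff (T : ScalarExt F V (LaurentSeries F) →+ ScalarExt F W (LaurentSeries F) →+
      ScalarExt F P (LaurentSeries F)) (β : V →ₗ[F] W →ₗ[F] P)
    (u : LaurentSeries F → LaurentSeries F) (c : ℤ → F)
    (hu : ∀ f n, (u f).coeff n = c n * f.coeff n)
    (hT : ∀ x f y g, T (ext x f) (ext y g) = ext (β x y) (u f * g))
    {m k : ℤ} {z : ScalarExt F V (LaurentSeries F)} {w : ScalarExt F W (LaurentSeries F)}
    (hz : m ≤ ord z) (hw : k ≤ ord w) :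
    ((m + k : ℤ) : WithTop ℤ) ≤ ord (T z w) ∧
      coeffAt (m + k) (T z w) = c m • β (coeffAt m z) (coeffAt k w) := by
  have h0 : ((m + k : ℤ) : WithTop ℤ) ≤ ord (0 : ScalarExt F P (LaurentSeries F)) := by
    rw [ord_eq_top_iff.2 rfl]; exact le_top
  -- With the thresholds `m` and `k` fixed, both assertions are additive in `z` and in `w`. It is
  -- therefore enough to treat pure tensors whose series have order at least `m` and `k`.
  refine ord_induction z hz (by simpa using h0) (fun x f hf => ?_) fun x y hx hy => ?_
  · refine ord_induction w hw (by simpa using h0) (fun y g hg => ?_) fun x y hx hy => ?_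
    · have hf' : (m : WithTop ℤ) ≤ (u f).orderTop := by
        rw [HahnSeries.le_orderTop_iff_forall] at hf ⊢
        intro n hn
        rw [hu, hf n hn, mul_zero]
      rw [hT]
      refine ⟨le_trans ?_ (le_ord_ext _ _), ?_⟩
      · rw [HahnSeries.orderTop_mul, WithTop.coe_add]
        exact add_le_add hf' hg
      · rw [coeffAt_ext, mul_coeff_add hf' hg, hu, coeffAt_ext, coeffAt_ext, map_smul, map_smul,
          LinearMap.smul_apply, smul_smul, smul_smul]
        congr 1
        ring
    · rw [map_add]
      refine ⟨(le_min hx.1 hy.1).trans (min_ord_le_ord_add _ _), ?_⟩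
      rw [map_add, hx.2, hy.2, map_add, map_add, smul_add]
  · rw [map_add, AddMonoidHom.add_apply]
    refine ⟨(le_min hx.1 hy.1).trans (min_ord_le_ord_add _ _), ?_⟩
    rw [map_add, hx.2, hy.2, map_add, map_add, LinearMap.add_apply, smul_add]

theorem coeffAt_extMap_iota (n : ℤ) (z : ScalarExt F V (LaurentSeries F)) :
    coeffAt n (extMap LinearMap.id (laurentIota F).toLinearMap z) = (-1 : F) ^ n • coeffAt n z := by
  induction z using ScalarExt.induction_on with
  | zero => simp
  | add x y hx hy => simp only [map_add, hx, hy, smul_add]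
  | tmul x f => simp [mul_smul]

theorem ord_extMap_iota (z : ScalarExt F V (LaurentSeries F)) :
    ord (extMap LinearMap.id (laurentIota F).toLinearMap z) = ord z := by
  refine eq_of_forall_le_iff fun m => ?_
  simp only [le_ord_iff, coeffAt_extMap_iota]
  simp [zpow_ne_zero]

end Series

/-! ### The valuation of `D ⊗ F((t))` and its action on `V ⊗ F((t))` -/

section Action

variable {F D V : Type*} [Field F] [DivisionRing D] [Algebra F D]
  [AddCommGroup V] [Module F V] [Module Dᵐᵒᵖ V] [IsScalarTower F Dᵐᵒᵖ V]

/-- An element of `D ⊗ F((t))`, seen in the scalar extension of `D`. -/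
noncomputable def asExt (F D : Type*) [Field F] [DivisionRing D] [Algebra F D] :
    D ⊗[F] LaurentSeries F ≃ₗ[F] ScalarExt F D (LaurentSeries F) := LinearEquiv.refl F _

theorem asExt_tmul (d : D) (f : LaurentSeries F) : asExt F D (d ⊗ₜ f) = ext d f := rfl

theorem series_asExt (a : D ⊗[F] LaurentSeries F) : series F D (asExt F D a) = toSeries F D a := by
  induction a using TensorProduct.induction_on with
  | zero => simp
  | add x y hx hy => simp only [map_add, hx, hy]
  | tmul d f =>
    ext n
    rw [asExt_tmul, series_ext_coeff, toSeries_tmul_coeff]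

/-- Identifies the valuation with the order function for `V = D`, so that the results on lowest
coefficients apply to scalars and to values of forms. -/
theorem hatVal_eq (a : D ⊗[F] LaurentSeries F) :
    hatVal F D a = intToRatTop (ord (asExt F D a)) := by
  rw [ord, series_asExt]; rfl

theorem intToRatTop_coe (n : ℤ) : intToRatTop n = ((n : ℚ) : WithTop ℚ) := rfl

theorem intToRatTop_top : intToRatTop ⊤ = ⊤ := rfl

theorem intToRatTop_injective : Function.Injective intToRatTop :=
  WithTop.map_injective Int.cast_injective

theorem intToRatTop_le_iff {a b : WithTop ℤ} : intToRatTop a ≤ intToRatTop b ↔ a ≤ b :=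
  (WithTop.strictMono_map_iff.2 fun _ _ h => Int.cast_lt.2 h : StrictMono intToRatTop).le_iff_le

theorem intToRatTop_lt_iff {a b : WithTop ℤ} : intToRatTop a < intToRatTop b ↔ a < b :=
  (WithTop.strictMono_map_iff.2 fun _ _ h => Int.cast_lt.2 h : StrictMono intToRatTop).lt_iff_lt

theorem hatVal_eq_top_iff {a : D ⊗[F] LaurentSeries F} : hatVal F D a = ⊤ ↔ a = 0 := by
  rw [hatVal_eq, ← intToRatTop_top, intToRatTop_injective.eq_iff, ord_eq_top_iff,
    LinearEquiv.map_eq_zero_iff]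

/-- The right action of `D` on `V` as a bilinear map. -/
noncomputable def rightAction (F D V : Type*) [Field F] [DivisionRing D] [Algebra F D]
    [AddCommGroup V] [Module F V] [Module Dᵐᵒᵖ V] [IsScalarTower F Dᵐᵒᵖ V] :
    V →ₗ[F] D →ₗ[F] V :=
  LinearMap.mk₂ F (fun x d => op d • x) (fun x y d => smul_add _ _ _)
    (fun a x d => by rw [smul_comm])
    (fun x d e => by rw [op_add, add_smul]) (fun a x d => by rw [op_smul, smul_assoc])

/-- The right action of `D ⊗ F((t))` on `V ⊗ F((t))` as a biadditive map. -/
noncomputable def extActionHom (F D V : Type*) [Field F] [DivisionRing D] [Algebra F D]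
    [AddCommGroup V] [Module F V] [Module Dᵐᵒᵖ V] [IsScalarTower F Dᵐᵒᵖ V] :
    ScalarExt F V (LaurentSeries F) →+ ScalarExt F D (LaurentSeries F) →+
      ScalarExt F V (LaurentSeries F) :=
  AddMonoidHom.mk' (fun x => AddMonoidHom.mk' (fun a => op ((asExt F D).symm a) • x)
    fun a b => by rw [map_add, op_add, add_smul]) fun x y => by ext a; simp

theorem smul_lowest {m k : ℤ} {z : ScalarExt F V (LaurentSeries F)} {a : D ⊗[F] LaurentSeries F}
    (hz : m ≤ ord z) (ha : k ≤ ord (asExt F D a)) :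
    ((m + k : ℤ) : WithTop ℤ) ≤ ord (op a • z) ∧
      coeffAt (m + k) (op a • z) = op (coeffAt k (asExt F D a)) • coeffAt m z := by
  have := lowest_coeff (extActionHom F D V) (rightAction F D V) id (fun _ => 1) (by simp)
    (fun x f y g => ext_smul x f y g) hz ha
  rwa [one_smul] at this

theorem op_zero_smul (z : ScalarExt F V (LaurentSeries F)) :
    op (0 : D ⊗[F] LaurentSeries F) • z = 0 := zero_smul (D ⊗[F] LaurentSeries F)ᵐᵒᵖ z

/-- The lowest coefficient of the product is a nonzero vector times a nonzero element of the
division ring `D`, hence nonzero. -/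
theorem ord_smul (a : D ⊗[F] LaurentSeries F) (z : ScalarExt F V (LaurentSeries F)) :
    ord (op a • z) = ord z + ord (asExt F D a) := by
  by_cases hz : z = 0
  · rw [hz, smul_zero, ord_eq_top_iff.2 rfl, top_add]
  by_cases ha : a = 0
  · rw [ha, op_zero_smul, map_zero, ord_eq_top_iff.2 rfl, ord_eq_top_iff.2 rfl, add_top]
  obtain ⟨m, hm⟩ := WithTop.ne_top_iff_exists.1 (mt ord_eq_top_iff.1 hz)
  obtain ⟨k, hk⟩ := WithTop.ne_top_iff_exists.1
    (mt ord_eq_top_iff.1 (mt (LinearEquiv.map_eq_zero_iff (asExt F D)).1 ha))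
  obtain ⟨h1, h2⟩ := smul_lowest hm.le hk.le
  rw [← hm, ← hk, ← WithTop.coe_add, ord_eq_iff]
  refine ⟨h1, ?_⟩
  rw [h2]
  exact smul_ne_zero ((op_ne_zero_iff _).2 (ord_eq_iff.1 hk.symm).2) (ord_eq_iff.1 hm.symm).2

theorem coeffAt_const_smul (n : ℤ) (d : D) (z : ScalarExt F V (LaurentSeries F)) :
    coeffAt n (op (d ⊗ₜ[F] (1 : LaurentSeries F)) • z) = op d • coeffAt n z := by
  induction z using ScalarExt.induction_on with
  | zero => simp
  | add x y hx hy => simp only [smul_add, map_add, hx, hy]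
  | tmul x f => rw [ext_smul, mul_one, coeffAt_ext, coeffAt_ext, smul_comm]

/-- Turns a relation among the vectors `eᵢ ⊗ 1` into relations among the `eᵢ` over `D`, one for each
power of `t`. -/
theorem coeffAt_smul_const (n : ℤ) (a : D ⊗[F] LaurentSeries F) (x : V) :
    coeffAt n (op a • ext x (1 : LaurentSeries F)) = op (coeffAt n (asExt F D a)) • x := by
  induction a using TensorProduct.induction_on with
  | zero => rw [op_zero_smul]; simp
  | add a b ha hb => simp only [op_add, add_smul, map_add, ha, hb]
  | tmul d f =>
    rw [ext_smul, one_mul, coeffAt_ext, asExt_tmul, coeffAt_ext, op_smul, smul_assoc]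

end Action

/-! ### Lowest coefficients of the extended forms -/

section Form

variable {F D V : Type*} [Field F] [DivisionRing D] [Algebra F D] {ρ : Involution F D} {δ : ℤˣ}
  [AddCommGroup V] [Module F V] [Module Dᵐᵒᵖ V] [IsScalarTower F Dᵐᵒᵖ V]

/-- The extension of `h` to `V ⊗ F((t))`. -/
noncomputable abbrev HermForm.hat (h : HermForm ρ δ V) :
    ScalarExt F V (LaurentSeries F) →ₗ[F] ScalarExt F V (LaurentSeries F) →ₗ[F]
      D ⊗[F] LaurentSeries F :=
  (h.tensor (laurentIota F) (laurentIota_laurentIota F)).bilin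

/-- Instance of `lowest_coeff` in which the left series is twisted by `ι`, which multiplies its
coefficient of `tᵐ` by `(-1)^m`. -/
theorem HermForm.hat_lowest (h : HermForm ρ δ V) {m k : ℤ}
    {z w : ScalarExt F V (LaurentSeries F)} (hz : m ≤ ord z) (hw : k ≤ ord w) :
    ((m + k : ℤ) : WithTop ℤ) ≤ ord (asExt F D (h.hat z w)) ∧
      coeffAt (m + k) (asExt F D (h.hat z w)) =
        (-1 : F) ^ m • h.bilin (coeffAt m z) (coeffAt k w) :=
  lowest_coeff (AddMonoidHom.mk' (fun x => (h.hat x).toAddMonoidHom)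
      fun x y => AddMonoidHom.ext fun z => LinearMap.congr_fun (map_add h.hat x y) z)
    h.bilin (laurentIota F) (fun n => (-1 : F) ^ n) laurentIota_coeff (fun _ _ _ _ => rfl) hz hw

/-- The candidate lowest coefficient is `± h(z_m, z_m)` with `z_m` the leading coefficient of `z`;
anisotropy keeps it from vanishing. -/
theorem HermForm.ord_hat_self (h : HermForm ρ δ V) (hh : h.Anisotropic)
    (z : ScalarExt F V (LaurentSeries F)) : ord (asExt F D (h.hat z z)) = ord z + ord z := by
  by_cases hz : z = 0
  · rw [hz, map_zero, map_zero, ord_eq_top_iff.2 rfl, ord_eq_top_iff.2 rfl, top_add]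
  obtain ⟨m, hm⟩ := WithTop.ne_top_iff_exists.1 (mt ord_eq_top_iff.1 hz)
  obtain ⟨h1, h2⟩ := h.hat_lowest hm.le hm.le
  rw [← hm, ← WithTop.coe_add, ord_eq_iff]
  refine ⟨h1, ?_⟩
  rw [h2]
  exact smul_ne_zero (zpow_ne_zero _ (by simp)) fun h0 => (ord_eq_iff.1 hm.symm).2 (hh _ h0)

theorem coeffAt_tPow_mul (n k : ℤ) (a : D ⊗[F] LaurentSeries F) :
    coeffAt n (asExt F D (((1 : D) ⊗ₜ[F] tPow F k) * a)) = coeffAt (n - k) (asExt F D a) := by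
  induction a using TensorProduct.induction_on with
  | zero => simp
  | add a b ha hb => simp only [mul_add, map_add, ha, hb]
  | tmul d f =>
    rw [Algebra.TensorProduct.tmul_mul_tmul, one_mul, asExt_tmul, asExt_tmul, coeffAt_ext,
      coeffAt_ext, tPow,
      HahnSeries.coeff_single_mul, one_mul]

theorem coeffAt_iotaD (n : ℤ) (a : D ⊗[F] LaurentSeries F) :
    coeffAt n (asExt F D (iotaD F D a)) = (-1 : F) ^ n • coeffAt n (asExt F D a) :=
  coeffAt_extMap_iota n (asExt F D a)

theorem hatVal_iotaD (a : D ⊗[F] LaurentSeries F) : hatVal F D (iotaD F D a) = hatVal F D a := by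
  rw [hatVal_eq, hatVal_eq]
  exact congrArg _ (ord_extMap_iota (asExt F D a))

theorem coeffAt_const_mul (n : ℤ) (c : F) (a : D ⊗[F] LaurentSeries F) :
    coeffAt n (asExt F D (((1 : D) ⊗ₜ[F] algebraMap F (LaurentSeries F) c) * a)) =
      algebraMap F D c * coeffAt n (asExt F D a) := by
  have : ((1 : D) ⊗ₜ[F] algebraMap F (LaurentSeries F) c) * a = c • a := by
    rw [Algebra.algebraMap_eq_smul_one, TensorProduct.tmul_smul, smul_mul_assoc,
      ← Algebra.TensorProduct.one_def, one_mul]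
  rw [this, map_smul, map_smul, Algebra.smul_def]

end Form

/-! ### The norm on `Û` and a splitting base -/

section Norm

variable {F D : Type*} [Field F] [DivisionRing D] [Algebra F D] {ρ : Involution F D}
  {V V₁ V₂ : Type*}
  [AddCommGroup V] [Module F V] [Module Dᵐᵒᵖ V] [IsScalarTower F Dᵐᵒᵖ V]
  [AddCommGroup V₁] [Module F V₁] [Module Dᵐᵒᵖ V₁] [IsScalarTower F Dᵐᵒᵖ V₁]
  [AddCommGroup V₂] [Module F V₂] [Module Dᵐᵒᵖ V₂] [IsScalarTower F Dᵐᵒᵖ V₂]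

theorem half_add_self (x : WithTop ℚ) : WithTop.map (fun q : ℚ => q / 2) (x + x) = x := by
  induction x using WithTop.recTopCoe with
  | top => rfl
  | coe q => rw [← WithTop.coe_add, WithTop.map_coe]; congr 1; ring

theorem half_one_add (x : WithTop ℚ) : WithTop.map (fun q : ℚ => q / 2) (1 + (x + x)) =
    x + ((1 / 2 : ℚ) : WithTop ℚ) := by
  induction x using WithTop.recTopCoe with
  | top => rfl
  | coe q =>
    rw [← WithTop.coe_one, ← WithTop.coe_add, ← WithTop.coe_add, ← WithTop.coe_add,
      WithTop.map_coe]
    congr 1; ring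

theorem half_mono : Monotone (WithTop.map (fun q : ℚ => q / 2)) :=
  Monotone.withTop_map fun _ _ h => by simpa using div_le_div_of_nonneg_right h zero_le_two

/-- The norm `min (ord x₁, ord x₂ + 1/2)` on `Û`. -/
noncomputable def hatNorm (z : HatU F V₁ V₂) : WithTop ℚ :=
  min (intToRatTop (ord z.1)) (intToRatTop (ord z.2) + ((1 / 2 : ℚ) : WithTop ℚ))

theorem hatForm_apply (h₁ : HermForm ρ 1 V₁) (h₂ : HermForm ρ (-1) V₂) (x y : HatU F V₁ V₂) :
    (hatForm h₁ h₂).bilin x y =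
      h₁.hat x.1 y.1 + ((1 : D) ⊗ₜ[F] tPow F 1) * h₂.hat x.2 y.2 := rfl

theorem hatVal_tPow (n : ℤ) : hatVal F D ((1 : D) ⊗ₜ[F] tPow F n) = ((n : ℚ) : WithTop ℚ) := by
  rw [hatVal_eq, asExt_tmul, ← intToRatTop_coe]
  congr 1
  exact ord_eq_iff.2 ⟨le_ord_ext_tPow _ _, by rw [coeffAt_ext_tPow]; exact one_ne_zero⟩

/-- The summands of `ĥ(z, z)` have valuations `2 ord z₁` and `1 + 2 ord z₂`. Being of different
parity, finite values are distinct, so the valuation of the sum is the minimum. -/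
theorem half_hatVal_hatForm {h₁ : HermForm ρ 1 V₁} {h₂ : HermForm ρ (-1) V₂}
    (hh₁ : h₁.Anisotropic) (hh₂ : h₂.Anisotropic) (z : HatU F V₁ V₂) :
    WithTop.map (fun q : ℚ => q / 2) (hatVal F D ((hatForm h₁ h₂).bilin z z)) = hatNorm z := by
  have e1 : hatVal F D (h₁.hat z.1 z.1) = intToRatTop (ord z.1) + intToRatTop (ord z.1) := by
    rw [hatVal_eq, h₁.ord_hat_self hh₁, map_add]
  have e2 : hatVal F D (((1 : D) ⊗ₜ[F] tPow F 1) * h₂.hat z.2 z.2) =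
      1 + (intToRatTop (ord z.2) + intToRatTop (ord z.2)) := by
    rw [AddValuation.map_mul, hatVal_tPow, hatVal_eq, h₂.ord_hat_self hh₂, map_add, Int.cast_one,
      WithTop.coe_one]
  have e : hatVal F D ((hatForm h₁ h₂).bilin z z) =
      min (hatVal F D (h₁.hat z.1 z.1))
        (hatVal F D (((1 : D) ⊗ₜ[F] tPow F 1) * h₂.hat z.2 z.2)) := by
    rw [hatForm_apply]
    by_cases hz : z = 0
    · subst hz
      simp
    -- Equal valuations are possible only if both are infinite, that is, if `z = 0`.
    · refine AddValuation.map_add_of_distinct_val _ fun h => hz ?_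
      rw [e1, e2] at h
      cases h1 : ord z.1 with
      | top =>
        cases h2 : ord z.2 with
        | top => exact Prod.ext (ord_eq_top_iff.1 h1) (ord_eq_top_iff.1 h2)
        | coe m =>
          rw [h1, h2, intToRatTop_coe, intToRatTop_top, top_add] at h
          exact (WithTop.top_ne_coe h).elim
      | coe k =>
        cases h2 : ord z.2 with
        | top =>
          rw [h1, h2, intToRatTop_coe, intToRatTop_top, top_add, add_top] at h
          exact (WithTop.coe_ne_top h).elim
        | coe m =>
          rw [h1, h2, intToRatTop_coe, intToRatTop_coe] at h
          have : k + k = 1 + (m + m) := by exact_mod_cast h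
          omega
  rw [e, half_mono.map_min, e1, e2, half_add_self, half_one_add, hatNorm]

theorem hatNorm_eq_top_iff {z : HatU F V₁ V₂} : hatNorm z = ⊤ ↔ z = 0 := by
  rw [hatNorm, min_eq_top, WithTop.add_eq_top, ← intToRatTop_top, intToRatTop_injective.eq_iff,
    intToRatTop_injective.eq_iff, ord_eq_top_iff, ord_eq_top_iff, Prod.ext_iff]
  simp [intToRatTop_top]

theorem min_hatNorm_le_add (x y : HatU F V₁ V₂) :
    min (hatNorm x) (hatNorm y) ≤ hatNorm (x + y) := by
  refine le_min ?_ ?_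
  · refine le_trans (min_le_min (min_le_left _ _) (min_le_left _ _)) ?_
    rw [← intToRatTop_mono.map_min]
    exact intToRatTop_mono (min_ord_le_ord_add _ _)
  · refine le_trans (min_le_min (min_le_right _ _) (min_le_right _ _)) ?_
    rw [min_add_add_right, ← intToRatTop_mono.map_min]
    exact add_le_add_left (intToRatTop_mono (min_ord_le_ord_add _ _)) _

theorem hatNorm_smul (a : D ⊗[F] LaurentSeries F) (z : HatU F V₁ V₂) :
    hatNorm (op a • z) = hatNorm z + hatVal F D a := by
  rw [hatNorm, hatNorm, Prod.smul_fst, Prod.smul_snd, ord_smul, ord_smul, map_add, map_add,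
    hatVal_eq, ← min_add_add_right, add_right_comm]

theorem hatNorm_iotaU (z : HatU F V₁ V₂) : hatNorm (iotaU F V₁ V₂ z) = hatNorm z := by
  have h1 : (iotaU F V₁ V₂ z).1 = extMap LinearMap.id (laurentIota F).toLinearMap z.1 := rfl
  have h2 : (iotaU F V₁ V₂ z).2 = extMap LinearMap.id (laurentIota F).toLinearMap z.2 := rfl
  rw [hatNorm, hatNorm, h1, h2, ord_extMap_iota, ord_extMap_iota]

/-- The coefficient of `tⁿ` of the sum is the combination of the `bᵢ` with the coefficients of `tⁿ`
of the `aᵢ`. By independence it vanishes exactly when all of these do, so no cancellation can raise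
the order. -/
theorem ord_sum_basis {ι : Type*} [Fintype ι] (b : Module.Basis ι Dᵐᵒᵖ V)
    (a : ι → D ⊗[F] LaurentSeries F) :
    ord (∑ i, op (a i) • ext (b i) (1 : LaurentSeries F)) =
      Finset.univ.inf fun i => ord (asExt F D (a i)) := by
  refine eq_of_forall_le_iff fun m => ?_
  simp only [le_ord_iff, Finset.le_inf_iff, map_sum, coeffAt_smul_const]
  refine ⟨fun h i _ n hn => ?_, fun h n hn => ?_⟩
  · have := Fintype.linearIndependent_iff.1 b.linearIndependent _ (h n hn) i
    rwa [op_eq_zero_iff] at this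
  · exact Finset.sum_eq_zero fun i hi => by rw [h i hi n hn, op_zero, zero_smul]

/-- Stated for an arbitrary submodule so that it can be applied to the preimages, under the two
inclusions into `Û`, of the span of the combined family. -/
theorem span_ext_basis {ι : Type*} (b : Module.Basis ι Dᵐᵒᵖ V)
    (S : Submodule (D ⊗[F] LaurentSeries F)ᵐᵒᵖ (ScalarExt F V (LaurentSeries F)))
    (hS : ∀ i, ext (b i) (1 : LaurentSeries F) ∈ S) : S = ⊤ := by
  refine Submodule.eq_top_iff'.2 fun z => ?_
  induction z using ScalarExt.induction_on with
  | zero => exact S.zero_mem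
  | add x y hx hy => exact S.add_mem hx hy
  | tmul x f =>
    have hx : x ∈ Submodule.span Dᵐᵒᵖ (Set.range b) := by rw [b.span_eq]; trivial
    induction hx using Submodule.span_induction with
    | mem x hx =>
      obtain ⟨i, rfl⟩ := hx
      have := S.smul_mem (op ((1 : D) ⊗ₜ[F] f)) (hS i)
      rwa [ext_smul, op_one, one_smul, one_mul] at this
    | zero => exact (zero_ext (F := F) (V := V) f).symm ▸ S.zero_mem
    | add x y _ _ hx hy => exact (add_ext x y f).symm ▸ S.add_mem hx hy
    | smul c x _ hx =>
      have := S.smul_mem (op (c.unop ⊗ₜ[F] (1 : LaurentSeries F))) hx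
      rwa [ext_smul, op_unop, mul_one] at this

/-- The elements `(eᵢ ⊗ 1, 0)` and `(0, fⱼ ⊗ 1)` of `Û`. -/
noncomputable def hatFamily {ι₁ ι₂ : Type*} (b₁ : ι₁ → V₁) (b₂ : ι₂ → V₂) :
    ι₁ ⊕ ι₂ → HatU F V₁ V₂ :=
  Sum.elim (fun i => (ext (b₁ i) 1, 0)) (fun j => (0, ext (b₂ j) 1))

theorem hatNorm_ext_left {x : V₁} (hx : x ≠ 0) (n : ℤ) :
    hatNorm ((ext x (tPow F n), 0) : HatU F V₁ V₂) = ((n : ℚ) : WithTop ℚ) := by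
  rw [hatNorm, ord_eq_top_iff.2 rfl, ord_eq_iff.2 ⟨le_ord_ext_tPow _ _, _⟩, intToRatTop_top,
    intToRatTop_coe, top_add, min_top_right]
  rwa [coeffAt_ext_tPow]

theorem hatNorm_ext_right {x : V₂} (hx : x ≠ 0) (n : ℤ) :
    hatNorm ((0, ext x (tPow F n)) : HatU F V₁ V₂) = ((n + 1 / 2 : ℚ) : WithTop ℚ) := by
  rw [hatNorm, ord_eq_top_iff.2 rfl, ord_eq_iff.2 ⟨le_ord_ext_tPow _ _, _⟩, intToRatTop_top,
    intToRatTop_coe, min_top_left, WithTop.coe_add]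
  rwa [coeffAt_ext_tPow]

theorem tPow_zero : tPow F 0 = 1 := rfl

theorem ext_one_ne_zero {x : V} (hx : x ≠ 0) :
    (ext x 1 : ScalarExt F V (LaurentSeries F)) ≠ 0 := fun h => by
  have := coeffAt_ext_tPow (F := F) x 0
  rw [tPow_zero, h, map_zero] at this
  exact hx this.symm

theorem hatNorm_sum_hatFamily {ι₁ ι₂ : Type*} [Fintype ι₁] [Fintype ι₂]
    (b₁ : Module.Basis ι₁ Dᵐᵒᵖ V₁) (b₂ : Module.Basis ι₂ Dᵐᵒᵖ V₂)
    (a : ι₁ ⊕ ι₂ → D ⊗[F] LaurentSeries F) :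
    hatNorm (∑ i, op (a i) • (hatFamily b₁ b₂ i : HatU F V₁ V₂)) =
      Finset.univ.inf fun i => hatNorm (hatFamily b₁ b₂ i : HatU F V₁ V₂) + hatVal F D (a i) := by
  have h1 : ∀ i, hatNorm (hatFamily b₁ b₂ (.inl i) : HatU F V₁ V₂) = 0 := fun i => by
    simpa [tPow_zero, hatFamily] using hatNorm_ext_left (F := F) (V₂ := V₂) (b₁.ne_zero i) 0
  have h2 : ∀ i, hatNorm (hatFamily b₁ b₂ (.inr i) : HatU F V₁ V₂) = ((1 / 2 : ℚ) : WithTop ℚ) :=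
    fun i => by
      simpa [tPow_zero, hatFamily] using hatNorm_ext_right (F := F) (V₁ := V₁) (b₂.ne_zero i) 0
  have e1 : (∑ i, op (a i) • (hatFamily b₁ b₂ i : HatU F V₁ V₂)).1 =
      ∑ i, op (a (.inl i)) • ext (b₁ i) (1 : LaurentSeries F) := by
    simp [Prod.fst_sum, hatFamily]
  have e2 : (∑ i, op (a i) • (hatFamily b₁ b₂ i : HatU F V₁ V₂)).2 =
      ∑ i, op (a (.inr i)) • ext (b₂ i) (1 : LaurentSeries F) := by
    simp [Prod.snd_sum, hatFamily]
  rw [hatNorm, e1, e2, ord_sum_basis, ord_sum_basis,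
    Finset.apply_inf_eq_inf_comp_of_linearOrder _ intToRatTop_mono intToRatTop_top,
    Finset.apply_inf_eq_inf_comp_of_linearOrder _ intToRatTop_mono intToRatTop_top,
    Finset.apply_inf_eq_inf_comp_of_linearOrder (fun x => x + ((1 / 2 : ℚ) : WithTop ℚ))
      (fun _ _ h => add_le_add_left h _) (top_add _)]
  refine eq_of_forall_le_iff fun m => ?_
  -- The base vectors have norm `0` on the first summand and `1/2` on the second, which accounts for
  -- the two shifts.
  simp only [le_min_iff, Finset.le_inf_iff, Finset.mem_univ, true_imp_iff, Sum.forall, h1, h2,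
    hatVal_eq, Function.comp_apply, zero_add, add_comm]

-- The base consists of `D`-bases of `V₁` and `V₂`, extended by constants.
variable (F D V₁ V₂) in
theorem exists_splitting_base [Module.Finite Dᵐᵒᵖ V₁] [Module.Finite Dᵐᵒᵖ V₂] :
    ∃ (n : ℕ) (e : Module.Basis (Fin n) (D ⊗[F] LaurentSeries F)ᵐᵒᵖ (HatU F V₁ V₂)),
      ∀ a : Fin n → D ⊗[F] LaurentSeries F, hatNorm (∑ i, op (a i) • e i) =
        Finset.univ.inf fun i => hatNorm (e i) + hatVal F D (a i) := by
  let b₁ := Module.finBasis Dᵐᵒᵖ V₁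
  let b₂ := Module.finBasis Dᵐᵒᵖ V₂
  let e : _ → HatU F V₁ V₂ := hatFamily b₁ b₂
  have hli : LinearIndependent (D ⊗[F] LaurentSeries F)ᵐᵒᵖ e := by
    refine Fintype.linearIndependent_iff.2 fun g hg i => ?_
    -- Linear independence is a consequence of the splitting formula: a vanishing combination has
    -- norm `∞`, hence so does each of its terms.
    have h := hatNorm_sum_hatFamily b₁ b₂ (fun i => (g i).unop)
    simp only [op_unop] at h
    rw [hatNorm_eq_top_iff.2 hg] at h
    have hi := (Finset.inf_eq_top_iff _ _).1 h.symm i (Finset.mem_univ i)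
    rw [WithTop.add_eq_top, hatNorm_eq_top_iff, hatVal_eq_top_iff] at hi
    refine unop_injective (hi.resolve_left fun h0 => ?_)
    rcases i with i | i
    · exact ext_one_ne_zero (b₁.ne_zero i) (congrArg Prod.fst h0)
    · exact ext_one_ne_zero (b₂.ne_zero i) (congrArg Prod.snd h0)
  have hsp : ⊤ ≤ Submodule.span (D ⊗[F] LaurentSeries F)ᵐᵒᵖ (Set.range e) := by
    rintro ⟨x, y⟩ -
    have hx := span_ext_basis b₁ ((Submodule.span _ (Set.range e)).comap (LinearMap.inl _ _ _))
      fun i => Submodule.subset_span ⟨.inl i, rfl⟩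
    have hy := span_ext_basis b₂ ((Submodule.span _ (Set.range e)).comap (LinearMap.inr _ _ _))
      fun i => Submodule.subset_span ⟨.inr i, rfl⟩
    have := Submodule.add_mem _ (Submodule.mem_comap.1 (Submodule.eq_top_iff'.1 hx x))
      (Submodule.mem_comap.1 (Submodule.eq_top_iff'.1 hy y))
    simpa using this
  refine ⟨_, (Module.Basis.mk hli hsp).reindex finSumFinEquiv, fun a => ?_⟩
  have := hatNorm_sum_hatFamily b₁ b₂ (fun i => a (finSumFinEquiv i))
  simp only [Module.Basis.reindex_apply, Module.Basis.mk_apply]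
  rw [← finSumFinEquiv.sum_comp]
  simp only [Equiv.symm_apply_apply]
  refine this.trans (eq_of_forall_le_iff fun m => ?_)
  simp only [Finset.le_inf_iff, Finset.mem_univ, true_imp_iff]
  exact ⟨fun h i => by simpa [e] using h (finSumFinEquiv.symm i),
    fun h i => by simpa [e] using h (finSumFinEquiv i)⟩

variable (F D V₁ V₂) in
/-- The norm `min (ord x₁, ord x₂ + 1/2)` as a `v`-norm. -/
noncomputable def hatVNorm [Module.Finite Dᵐᵒᵖ V₁] [Module.Finite Dᵐᵒᵖ V₂] :
    VNorm (hatVal F D) (HatU F V₁ V₂) where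
  toFun := hatNorm
  eq_top_iff' _ := hatNorm_eq_top_iff
  min_le_add' := min_hatNorm_le_add
  map_smul' := hatNorm_smul
  exists_splitting' := exists_splitting_base F D V₁ V₂

end Norm

/-! ### Square roots of power series and norms from `F((t))` -/

section SquareRoot

variable {F : Type*} [Field F]

/-- The coefficients of a square root of a power series with constant coefficient `1`. -/
noncomputable def sqrtCoeff (f : ℕ → F) : ℕ → F
  | 0 => 1
  | n + 1 => (f (n + 1) - ∑ i : Fin n, sqrtCoeff f (i + 1) * sqrtCoeff f (n - i)) / 2
decreasing_by all_goals omega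

/-- In `g² = f` with `g₀ = 1`, the equation in degree `n + 1` is linear in the new unknown `g_{n+1}`
with coefficient `2`, so it can be solved recursively. -/
theorem exists_sq_eq_of_constantCoeff_eq_one (hF : (2 : F) ≠ 0) (f : PowerSeries F)
    (hf : PowerSeries.constantCoeff f = 1) : ∃ g : PowerSeries F, g * g = f := by
  let c := sqrtCoeff fun n => PowerSeries.coeff n f
  have h0 : c 0 = 1 := by simp [c, sqrtCoeff]
  refine ⟨PowerSeries.mk c, ?_⟩
  ext n
  rw [PowerSeries.coeff_mul, Finset.Nat.sum_antidiagonal_eq_sum_range_succ_mk]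
  simp only [PowerSeries.coeff_mk]
  rcases n with _ | n
  · simpa [h0] using hf.symm
  · have h : c (n + 1) = (PowerSeries.coeff (n + 1) f -
        ∑ i ∈ Finset.range n, c (i + 1) * c (n - i)) / 2 := by
      rw [← Fin.sum_univ_eq_sum_range (fun i => c (i + 1) * c (n - i))]
      simp only [c]
      rw [sqrtCoeff]
    -- The two extreme terms of the convolution are split off; each equals `c (n + 1)`.
    rw [Finset.sum_range_succ, Finset.sum_range_succ', Nat.sub_self, h0, Nat.sub_zero, mul_one,
      one_mul]
    simp only [Nat.add_sub_add_right]
    rw [add_assoc, ← two_mul, h, mul_div_cancel₀ _ hF, add_sub_cancel]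

theorem laurentIota_tPow (n : ℤ) : laurentIota F (tPow F n) = (-1 : F) ^ n • tPow F n := by
  ext k
  by_cases hk : k = n <;> simp [tPow, hk]

/-- `f(t) ↦ f(t²)`. -/
noncomputable def substSq (F : Type*) [Field F] : LaurentSeries F →ₐ[F] LaurentSeries F :=
  HahnSeries.embDomainAlgHom (R := F) (A := F) (AddMonoidHom.mulLeft (2 : ℤ))
    (fun a b h => by simpa using h) (fun a b => by simp)

theorem laurentIota_substSq (f : LaurentSeries F) : laurentIota F (substSq F f) = substSq F f := by
  ext n
  rw [laurentIota_coeff]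
  by_cases hn : ∃ k, n = 2 * k
  · obtain ⟨k, rfl⟩ := hn
    rw [zpow_mul]
    simp
  · have : (substSq F f).coeff n = 0 := HahnSeries.embDomain_of_notMem_range fun ⟨k, hk⟩ =>
      hn ⟨k, hk.symm⟩
    rw [this, mul_zero]

theorem substSq_tPow (n : ℤ) : substSq F (tPow F n) = tPow F n * tPow F n := by
  rw [tPow, HahnSeries.single_mul_single, mul_one, ← two_mul]
  exact HahnSeries.embDomain_single

/-- Up to a constant, the nonzero elements of `F((t²))` are norms from `F((t))`. -/
theorem exists_eq_norm (hF : (2 : F) ≠ 0) {m : LaurentSeries F} (hm : m ∈ laurentSq F)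
    (hm0 : m ≠ 0) : ∃ (a : F) (c : LaurentSeries F), a ≠ 0 ∧ c ≠ 0 ∧
      m = a • (laurentIota F c * c) := by
  -- Membership in `laurentSq` is by definition membership in the range of `substSq`.
  obtain ⟨f, hf⟩ : ∃ f, substSq F f = m := hm
  have hf0 : f ≠ 0 := by
    rintro rfl
    exact hm0 (by rw [← hf, map_zero])
  set p := f.powerSeriesPart
  set b := PowerSeries.constantCoeff p
  -- The constant coefficient of the power series part is the leading coefficient of `f`.
  have hb : b ≠ 0 := by
    have := LaurentSeries.powerSeriesPart_coeff f 0
    rw [PowerSeries.coeff_zero_eq_constantCoeff_apply] at this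
    simpa [b, p, this] using hf0
  obtain ⟨g, hg⟩ := exists_sq_eq_of_constantCoeff_eq_one hF (b⁻¹ • p) (by simp [b, hb])
  have hfg : f = b • (tPow F f.order * (HahnSeries.ofPowerSeries ℤ F g *
      HahnSeries.ofPowerSeries ℤ F g)) := by
    have hC : HahnSeries.C b * (HahnSeries.C b⁻¹ : LaurentSeries F) = 1 := by
      rw [← map_mul, mul_inv_cancel₀ hb, map_one]
    rw [← map_mul, hg, PowerSeries.smul_eq_C_mul, map_mul, HahnSeries.ofPowerSeries_C,
      ← HahnSeries.C_mul_eq_smul, mul_left_comm (tPow F f.order), ← mul_assoc, hC, one_mul]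
    exact (LaurentSeries.single_order_mul_powerSeriesPart f).symm
  -- As a series in `t²`, `u` is fixed by `ι`. Only the factor `t ^ f.order` of the norm generator
  -- changes under `ι`, and the sign `(-1) ^ f.order` in the constant compensates for it.
  let u := substSq F (HahnSeries.ofPowerSeries ℤ F g)
  have hm' : m = (b * (-1) ^ f.order) • (laurentIota F (tPow F f.order * u) *
      (tPow F f.order * u)) := by
    rw [← hf]
    conv_lhs => rw [hfg]
    rw [map_smul, map_mul, map_mul, map_mul, laurentIota_tPow, laurentIota_substSq, substSq_tPow,
      smul_mul_assoc, smul_mul_assoc, smul_smul, mul_assoc b, ← mul_zpow]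
    simp only [mul_neg, mul_one, neg_neg, one_zpow, u]
    congr 1
    ring
  refine ⟨_, _, mul_ne_zero hb (zpow_ne_zero _ (by simp)), fun h => hm0 ?_, hm'⟩
  rw [hm', h]
  simp

end SquareRoot

/-! ### Reduction to similitudes with constant multiplier -/

section Rescale

variable {F D : Type*} [Field F] [DivisionRing D] [Algebra F D] {ρ : Involution F D}
  {V V₁ V₂ : Type*}
  [AddCommGroup V] [Module F V] [Module Dᵐᵒᵖ V] [IsScalarTower F Dᵐᵒᵖ V]
  [AddCommGroup V₁] [Module F V₁] [Module Dᵐᵒᵖ V₁] [IsScalarTower F Dᵐᵒᵖ V₁]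
  [AddCommGroup V₂] [Module F V₂] [Module Dᵐᵒᵖ V₂] [IsScalarTower F Dᵐᵒᵖ V₂]

theorem op_smul_op_smul (a b : D ⊗[F] LaurentSeries F) (z : ScalarExt F V (LaurentSeries F)) :
    op a • op b • z = op (b * a) • z := by rw [smul_smul, op_mul]

theorem one_tmul_smul_comm (c : LaurentSeries F) (a : (D ⊗[F] LaurentSeries F)ᵐᵒᵖ)
    (z : ScalarExt F V (LaurentSeries F)) :
    op ((1 : D) ⊗ₜ[F] c) • a • z = a • op ((1 : D) ⊗ₜ[F] c) • z := by
  rw [← op_unop a, op_smul_op_smul, op_smul_op_smul, one_tmul_comm]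

/-- Multiplication by an element of `F((t))` on `Û`. -/
noncomputable def centralSMul (F D V₁ V₂ : Type*) [Field F] [DivisionRing D] [Algebra F D]
    [AddCommGroup V₁] [Module F V₁] [Module Dᵐᵒᵖ V₁] [IsScalarTower F Dᵐᵒᵖ V₁]
    [AddCommGroup V₂] [Module F V₂] [Module Dᵐᵒᵖ V₂] [IsScalarTower F Dᵐᵒᵖ V₂]
    (c : LaurentSeries F) :
    HatU F V₁ V₂ →ₗ[(D ⊗[F] LaurentSeries F)ᵐᵒᵖ] HatU F V₁ V₂ where
  toFun x := op ((1 : D) ⊗ₜ[F] c) • x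
  map_add' x y := Prod.ext (smul_add _ x.1 y.1) (smul_add _ x.2 y.2)
  map_smul' a x := Prod.ext (one_tmul_smul_comm c a x.1) (one_tmul_smul_comm c a x.2)

theorem extMap_iota_smul (a : D ⊗[F] LaurentSeries F) (z : ScalarExt F V (LaurentSeries F)) :
    extMap LinearMap.id (laurentIota F).toLinearMap (op a • z) =
      op (iotaD F D a) • extMap LinearMap.id (laurentIota F).toLinearMap z := by
  induction z using ScalarExt.induction_on with
  | zero => simp
  | add x y hx hy => simp only [smul_add, map_add, hx, hy]
  | tmul x f =>
  induction a using TensorProduct.induction_on with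
  | zero => rw [map_zero, op_zero_smul, op_zero_smul, map_zero]
  | add x y hx hy => simp only [op_add, add_smul, map_add, hx, hy]
  | tmul d g =>
    rw [ext_smul]
    simp [iotaD, ext_smul]

theorem iotaU_smul (a : D ⊗[F] LaurentSeries F) (x : HatU F V₁ V₂) :
    iotaU F V₁ V₂ (op a • x) = op (iotaD F D a) • iotaU F V₁ V₂ x :=
  Prod.ext (extMap_iota_smul a x.1) (extMap_iota_smul a x.2)

/-- On central scalars the conjugations on `Û` and on `D̂` undo each other, so `ĥ^ι` is sesquilinear
for the same involution as `ĥ` there: `c` comes out as `ι(c)` on the left and as `c` on the right.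
-/
theorem conjForm_centralSMul (h₁ : HermForm ρ 1 V₁) (h₂ : HermForm ρ (-1) V₂)
    (c : LaurentSeries F) (x y : HatU F V₁ V₂) :
    conjForm h₁ h₂ (centralSMul F D V₁ V₂ c x) (centralSMul F D V₁ V₂ c y) =
      ((1 : D) ⊗ₜ[F] (laurentIota F c * c)) * conjForm h₁ h₂ x y := by
  change iotaD F D ((hatForm h₁ h₂).bilin (iotaU F V₁ V₂ (op ((1 : D) ⊗ₜ[F] c) • x))
    (iotaU F V₁ V₂ (op ((1 : D) ⊗ₜ[F] c) • y))) = _ * iotaD F D ((hatForm h₁ h₂).bilin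
      (iotaU F V₁ V₂ x) (iotaU F V₁ V₂ y))
  have h : ∀ f : LaurentSeries F, iotaD F D ((1 : D) ⊗ₜ[F] f) = 1 ⊗ₜ laurentIota F f := fun f => rfl
  have h' : (hatInvolution ρ).toLinearMap ((1 : D) ⊗ₜ[F] laurentIota F c) = 1 ⊗ₜ c := by
    change ρ.toLinearMap 1 ⊗ₜ laurentIota F (laurentIota F c) = _
    rw [ρ.map_one, laurentIota_laurentIota]
  rw [iotaU_smul, iotaU_smul, (hatForm h₁ h₂).smul_left, (hatForm h₁ h₂).smul_right, h, h',
    map_mul, map_mul, h, h, laurentIota_laurentIota, ← one_tmul_comm, ← mul_assoc,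
    Algebra.TensorProduct.tmul_mul_tmul, one_mul]

theorem algebraMap_mem_laurentSq (a : F) : algebraMap F (LaurentSeries F) a ∈ laurentSq F :=
  (laurentSq F).algebraMap_mem a

/-- A similitude is a multiple of a similitude with constant multiplier. -/
theorem exists_constant_multiplier (hF : (2 : F) ≠ 0) (h₁ : HermForm ρ 1 V₁)
    (h₂ : HermForm ρ (-1) V₂) (g : HatU F V₁ V₂ →ₗ[(D ⊗[F] LaurentSeries F)ᵐᵒᵖ] HatU F V₁ V₂)
    (hg : IsHatSimilitude h₁ h₂ g) :
    ∃ (c : LaurentSeries F)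
      (g' : HatU F V₁ V₂ →ₗ[(D ⊗[F] LaurentSeries F)ᵐᵒᵖ] HatU F V₁ V₂) (a : F),
      c ≠ 0 ∧ a ≠ 0 ∧ IsHatSimilitude h₁ h₂ g' ∧
      HasHatMultiplier h₁ h₂ g' (algebraMap F (LaurentSeries F) a) ∧
      ∀ x, g x = op ((1 : D) ⊗ₜ[F] c) • g' x := by
  obtain ⟨m, hm, hm0, hg⟩ := hg
  obtain ⟨a, c, ha, hc, rfl⟩ := exists_eq_norm hF hm hm0
  -- Dividing `g` by `c` divides its multiplier `a ι(c) c` by `ι(c) c`.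
  have h : HasHatMultiplier h₁ h₂ (centralSMul F D V₁ V₂ c⁻¹ ∘ₗ g)
      (algebraMap F (LaurentSeries F) a) := by
    intro x y
    rw [LinearMap.comp_apply, LinearMap.comp_apply, conjForm_centralSMul, hg x y, ← mul_assoc,
      Algebra.TensorProduct.tmul_mul_tmul, one_mul]
    congr 2
    have : laurentIota F c ≠ 0 := (map_ne_zero_iff _ (laurentIota F).toRingHom.injective).2 hc
    rw [Algebra.smul_def, map_inv₀]
    field_simp
  refine ⟨c, _, a, hc, ha, ⟨_, algebraMap_mem_laurentSq a, ?_, h⟩, h, fun x => ?_⟩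
  · exact (map_ne_zero_iff _ (algebraMap F (LaurentSeries F)).injective).2 ha
  · change g x = op ((1 : D) ⊗ₜ[F] c) • op ((1 : D) ⊗ₜ[F] c⁻¹) • g x
    have h1 : ((1 : D) ⊗ₜ[F] c⁻¹) * ((1 : D) ⊗ₜ[F] c) = 1 := by
      rw [Algebra.TensorProduct.tmul_mul_tmul, inv_mul_cancel₀ hc, one_mul,
        Algebra.TensorProduct.one_def]
    refine Prod.ext ?_ ?_
    · change (g x).1 = op ((1 : D) ⊗ₜ[F] c) • op ((1 : D) ⊗ₜ[F] c⁻¹) • (g x).1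
      rw [op_smul_op_smul, h1, op_one, one_smul]
    · change (g x).2 = op ((1 : D) ⊗ₜ[F] c) • op ((1 : D) ⊗ₜ[F] c⁻¹) • (g x).2
      rw [op_smul_op_smul, h1, op_one, one_smul]

end Rescale

/-! ### Homogeneous components of associated graded groups -/

namespace ValueFn

variable {M V : Type*} [AddCommGroup M] [AddCommGroup V]

theorem cls_eq_cls_of_lt_sub (w : ValueFn M) {γ : ℚ} {x y : M} (hx : (γ : WithTop ℚ) ≤ w x)
    (hy : (γ : WithTop ℚ) ≤ w y) (h : (γ : WithTop ℚ) < w (x - y)) :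
    w.cls γ x hx = w.cls γ y hy := by
  rw [← sub_eq_zero, ← w.cls_eq_zero h.le h, cls, cls, cls, ← map_sub]
  rfl

/-- Allowing the value `⊤` covers the zero vector, whose leading class is `0`, together with the
vectors of exact value `γ`. -/
theorem lead_eq_cls (w : ValueFn M) {γ : ℚ} {x : M} (hx : (γ : WithTop ℚ) ≤ w x)
    (h : w x = ⊤ ∨ w x = γ) : w.lead x = w.cls γ x hx := by
  rcases h with h | h
  · rw [lead, dif_pos h, w.cls_eq_zero hx (by rw [h]; exact WithTop.coe_lt_top _)]
  · rw [lead, dif_neg (by rw [h]; exact WithTop.coe_ne_top)]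
    exact w.cls_congr (by simp [h]) rfl _

/-- The homomorphism `∑ₙ xₙ ↦ ∑ₙ (sₙ(xₙ) + M_{>γₙ})`. -/
noncomputable def expand (w : ValueFn M) (γ : ℤ → ℚ) (s : ℤ → V →+ M)
    (hs : ∀ n x, (γ n : WithTop ℚ) ≤ w (s n x)) : (ℤ →₀ V) →+ w.Gr :=
  Finsupp.liftAddHom fun n => AddMonoidHom.mk' (fun x => w.cls (γ n) (s n x) (hs n x)) fun x y => by
    rw [← cls_add]
    exact cls_congr _ rfl (map_add _ _ _) _

theorem expand_single (w : ValueFn M) (γ : ℤ → ℚ) (s : ℤ → V →+ M)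
    (hs : ∀ n x, (γ n : WithTop ℚ) ≤ w (s n x)) (n : ℤ) (x : V) :
    w.expand γ s hs (Finsupp.single n x) = w.cls (γ n) (s n x) (hs n x) :=
  Finsupp.liftAddHom_apply_single _ _ _

open Classical in
/-- The homomorphism which maps `x + M_{>γₙ}` to `cₙ(x)` in degree `n`, and is zero in the degrees
not of the form `γₙ`. -/
noncomputable def extract (w : ValueFn M) (γ : ℤ → ℚ) (c : ℤ → M →+ V)
    (hc : ∀ n x, (γ n : WithTop ℚ) < w x → c n x = 0) : w.Gr →+ (ℤ →₀ V) :=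
  w.grLift (fun δ => if h : ∃ n, γ n = δ then
      ((Finsupp.singleAddHom h.choose).comp (c h.choose)).comp (w.ge δ).subtype else 0)
    fun δ x hx => by
      split_ifs with h
      · simp [hc h.choose x (by rwa [h.choose_spec])]
      · rfl

theorem extract_cls (w : ValueFn M) {γ : ℤ → ℚ} (hγ : Function.Injective γ) (c : ℤ → M →+ V)
    (hc : ∀ n x, (γ n : WithTop ℚ) < w x → c n x = 0) (n : ℤ) (x : M)
    (hx : (γ n : WithTop ℚ) ≤ w x) :
    w.extract γ c hc (w.cls (γ n) x hx) = Finsupp.single n (c n x) := by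
  have h : ∃ k, γ k = γ n := ⟨n, rfl⟩
  rw [extract, grLift_cls, dif_pos h]
  -- Injectivity of `γ` makes the chosen index the given one.
  have h' : h.choose = n := hγ h.choose_spec
  simp [h']

theorem extract_cls_of_notMem (w : ValueFn M) {γ : ℤ → ℚ} (c : ℤ → M →+ V)
    (hc : ∀ n x, (γ n : WithTop ℚ) < w x → c n x = 0) {δ : ℚ} (hδ : ∀ n, γ n ≠ δ) (x : M)
    (hx : (δ : WithTop ℚ) ≤ w x) : w.extract γ c hc (w.cls δ x hx) = 0 := by
  rw [extract, grLift_cls, dif_neg (fun ⟨n, hn⟩ => hδ n hn)]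
  rfl

end ValueFn

/-! ### Decomposition of `V ⊗ F[t, t⁻¹]` into monomials -/

section LaurentTensor

variable {F V : Type*} [Field F] [AddCommGroup V] [Module F V]

/-- `V ⊗ F[t, t⁻¹]` is the sum of the groups `V ⊗ tⁿ`. -/
noncomputable def laurentEquiv (F V : Type*) [Field F] [AddCommGroup V] [Module F V] :
    ScalarExt F V F[T;T⁻¹] ≃ₗ[F] (ℤ →₀ V) :=
  ((AddMonoidAlgebra.coeffLinearEquiv F).lTensor V ≪≫ₗ TensorProduct.finsuppScalarRight F F V ℤ :
    V ⊗[F] F[T;T⁻¹] ≃ₗ[F] (ℤ →₀ V))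

theorem laurentEquiv_symm_single (n : ℤ) (x : V) :
    (laurentEquiv F V).symm (Finsupp.single n x) = ext x (LaurentPolynomial.T n) := by
  rw [laurentEquiv]
  erw [LinearEquiv.trans_symm]
  erw [LinearEquiv.trans_apply, TensorProduct.finsuppScalarRight_symm_apply_single]
  rfl

theorem laurentEquiv_ext (n : ℤ) (x : V) :
    laurentEquiv F V (ext x (LaurentPolynomial.T n)) = Finsupp.single n x := by
  rw [← laurentEquiv_symm_single, LinearEquiv.apply_symm_apply]

@[elab_as_elim]
theorem laurentTensor_induction {p : ScalarExt F V F[T;T⁻¹] → Prop} (z : ScalarExt F V F[T;T⁻¹])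
    (zero : p 0) (single : ∀ x n, p (ext x (LaurentPolynomial.T n)))
    (add : ∀ x y, p x → p y → p (x + y)) : p z := by
  rw [← (laurentEquiv F V).symm_apply_apply z]
  induction laurentEquiv F V z using Finsupp.induction_linear with
  | zero => rwa [map_zero]
  | add x y hx hy => rw [map_add]; exact add _ _ hx hy
  | single n x => rw [laurentEquiv_symm_single]; exact single x n

end LaurentTensor

/-! ### The graded ring of `D ⊗ F((t))` -/

section GradedRing

variable (F D : Type*) [Field F] [DivisionRing D] [Algebra F D]

/-- `d ↦ d ⊗ tⁿ`. -/
noncomputable def extTPow (F V : Type*) [Field F] [AddCommGroup V] [Module F V] (n : ℤ) :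
    V →+ ScalarExt F V (LaurentSeries F) :=
  AddMonoidHom.mk' (fun x => ext x (tPow F n)) fun x y => add_ext x y _

theorem le_intToRatTop_iff {n : ℤ} {a : WithTop ℤ} :
    ((n : ℚ) : WithTop ℚ) ≤ intToRatTop a ↔ (n : WithTop ℤ) ≤ a := by
  rw [← intToRatTop_coe, intToRatTop_le_iff]

theorem lt_intToRatTop_iff {n : ℤ} {a : WithTop ℤ} :
    ((n : ℚ) : WithTop ℚ) < intToRatTop a ↔ (n : WithTop ℤ) < a := by
  rw [← intToRatTop_coe, intToRatTop_lt_iff]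

theorem eq_top_or_exists_intCast (a : WithTop ℤ) :
    intToRatTop a = ⊤ ∨ ∃ n : ℤ, intToRatTop a = ((n : ℚ) : WithTop ℚ) := by
  induction a using WithTop.recTopCoe with
  | top => exact .inl rfl
  | coe n => exact .inr ⟨n, rfl⟩

/-- The additive isomorphism of `D ⊗ F[t, t⁻¹]` and `gr(D ⊗ F((t)))`. -/
noncomputable def grRingEquivAux : (ℤ →₀ D) ≃+ (valueFn (hatVal F D)).Gr :=
  let w := valueFn (hatVal F D)
  have hw : ∀ a, w a = intToRatTop (ord (asExt F D a)) := hatVal_eq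
  let s : ℤ → D →+ D ⊗[F] LaurentSeries F := extTPow F D
  have hs : ∀ (n : ℤ) (x : D), (((n : ℤ) : ℚ) : WithTop ℚ) ≤ w (s n x) := fun n x => by
    rw [hw, le_intToRatTop_iff]; exact le_ord_ext_tPow x n
  let c : ℤ → D ⊗[F] LaurentSeries F →+ D := fun n => (coeffAt n : _ →ₗ[F] D).toAddMonoidHom
  have hc : ∀ (n : ℤ) x, (((n : ℤ) : ℚ) : WithTop ℚ) < w x → c n x = 0 := fun n x h =>
    coeffAt_eq_zero (lt_intToRatTop_iff.1 (h.trans_eq (hw x)))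
  AddMonoidHom.toAddEquiv (w.expand (fun n => n) s hs) (w.extract (fun n => n) c hc)
    (by
      ext n x : 2
      simp only [AddMonoidHom.comp_apply, Finsupp.singleAddHom_apply, AddMonoidHom.id_apply]
      rw [w.expand_single, w.extract_cls Int.cast_injective]
      exact congrArg _ (coeffAt_ext_tPow (F := F) x n))
    (by
      refine AddMonoidHom.ext fun z => ?_
      induction z using ValueFn.Gr.induction_on with
      | zero => simp only [map_zero]
      | add x y hx hy => rw [map_add, hx, hy, map_add]
      | cls γ x hx =>
        rw [AddMonoidHom.comp_apply, AddMonoidHom.id_apply]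
        -- In an integral degree a class is represented by its leading monomial. In any other degree
        -- the piece is zero, because the valuation takes only integral values and `∞`.
        by_cases h : ∃ n : ℤ, (n : ℚ) = γ
        · obtain ⟨n, rfl⟩ := h
          rw [w.extract_cls (γ := fun n : ℤ => (n : ℚ)) Int.cast_injective, w.expand_single]
          refine (w.cls_eq_cls_of_lt_sub hx _ ?_).symm
          rw [hw] at hx ⊢
          rw [lt_intToRatTop_iff]
          exact lt_ord_sub_ext (le_intToRatTop_iff.1 hx)
        · rw [w.extract_cls_of_notMem _ _ fun n hn => h ⟨n, hn⟩, map_zero, w.cls_eq_zero]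
          refine lt_of_le_of_ne hx fun h' => ?_
          rcases eq_top_or_exists_intCast (ord (asExt F D x)) with hx' | ⟨n, hx'⟩
          · exact WithTop.coe_ne_top (h'.trans ((hw x).trans hx'))
          · exact h ⟨n, (WithTop.coe_injective (h'.trans ((hw x).trans hx'))).symm⟩)

theorem le_hatVal_tmul (d : D) (n : ℤ) :
    ((n : ℚ) : WithTop ℚ) ≤ hatVal F D (d ⊗ₜ[F] tPow F n) := by
  rw [hatVal_eq, le_intToRatTop_iff]
  exact le_ord_ext_tPow d n

theorem grRingEquivAux_single (n : ℤ) (d : D) : grRingEquivAux F D (Finsupp.single n d) =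
    GrRing.cls (hatVal F D) n (d ⊗ₜ tPow F n) (le_hatVal_tmul F D d n) :=
  ValueFn.expand_single _ _ _ _ _ _

/-- The additive isomorphism underlying `grRingEquiv`. -/
noncomputable def grRingAddEquiv : D ⊗[F] F[T;T⁻¹] ≃+ GrRing (hatVal F D) :=
  (laurentEquiv F D).toAddEquiv.trans (grRingEquivAux F D : (ℤ →₀ D) ≃+ GrRing (hatVal F D))

theorem grRingAddEquiv_tmul (d : D) (n : ℤ) :
    grRingAddEquiv F D (d ⊗ₜ LaurentPolynomial.T n) =
      GrRing.cls (hatVal F D) n (d ⊗ₜ tPow F n) (le_hatVal_tmul F D d n) := by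
  rw [← grRingEquivAux_single, ← laurentEquiv_ext (F := F)]
  rfl

theorem tPow_mul_tPow (m n : ℤ) : tPow F m * tPow F n = tPow F (m + n) := by
  simp [tPow, HahnSeries.single_mul_single]

variable {F D} in
@[elab_as_elim]
theorem tmul_T_induction {p : D ⊗[F] F[T;T⁻¹] → Prop} (z : D ⊗[F] F[T;T⁻¹]) (zero : p 0)
    (tmul : ∀ d n, p (d ⊗ₜ LaurentPolynomial.T n)) (add : ∀ x y, p x → p y → p (x + y)) : p z :=
  laurentTensor_induction (V := D) z zero tmul add

/-- The ring isomorphism `D ⊗ F[t, t⁻¹] ≃ gr(D ⊗ F((t)))`. -/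
noncomputable def grRingEquiv : D ⊗[F] F[T;T⁻¹] ≃+* GrRing (hatVal F D) :=
  { grRingAddEquiv F D with
    map_mul' := fun x y => by
      change grRingAddEquiv F D (x * y) =
        grRingMul _ (grRingAddEquiv F D x) (grRingAddEquiv F D y)
      induction x using tmul_T_induction with
      | zero => simp only [zero_mul, map_zero, AddMonoidHom.zero_apply]
      | add x x' h h' => simp only [add_mul, map_add, AddMonoidHom.add_apply, h, h']
      | tmul d m =>
      induction y using tmul_T_induction with
      | zero => simp only [mul_zero, map_zero]
      | add y y' h h' => simp only [mul_add, map_add, h, h']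
      | tmul e n =>
        rw [Algebra.TensorProduct.tmul_mul_tmul, ← LaurentPolynomial.T_add, grRingAddEquiv_tmul,
          grRingAddEquiv_tmul, grRingAddEquiv_tmul, grRingMul_cls]
        refine GrRing.cls_congr (Int.cast_add m n) ?_ _
        rw [Algebra.TensorProduct.tmul_mul_tmul, tPow_mul_tPow] }

theorem grRingEquiv_tmul (d : D) (n : ℤ) :
    grRingEquiv F D (d ⊗ₜ LaurentPolynomial.T n) =
      GrRing.cls (hatVal F D) n (d ⊗ₜ tPow F n) (le_hatVal_tmul F D d n) :=
  grRingAddEquiv_tmul F D d n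

theorem lead_tmul_tPow (d : D) (n : ℤ) : GrRing.lead (hatVal F D) (d ⊗ₜ tPow F n) =
    GrRing.cls (hatVal F D) n (d ⊗ₜ tPow F n) (le_hatVal_tmul F D d n) := by
  refine ValueFn.lead_eq_cls _ _ ?_
  by_cases hd : d = 0
  · left
    change hatVal F D _ = ⊤
    rw [hd, TensorProduct.zero_tmul, AddValuation.map_zero]
  · right
    change hatVal F D _ = _
    rw [hatVal_eq, asExt_tmul, ← intToRatTop_coe]
    exact congrArg _ (ord_eq_iff.2 ⟨le_ord_ext_tPow _ _, by rwa [coeffAt_ext_tPow]⟩)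

end GradedRing

/-! ### The filtration of `Û` in integral and half-integral degrees -/

section NormCuts

variable {F V₁ V₂ : Type*} [Field F] [AddCommGroup V₁] [Module F V₁] [AddCommGroup V₂] [Module F V₂]

/-- Orders are integers or `∞`, so no value lies strictly between `n` and `n + 1`: comparison with
`n + 1/2`, strict or not, is strict comparison with `n`. -/
theorem lt_intToRatTop_of_half {n : ℤ} {a : WithTop ℤ} :
    ((n + 1 / 2 : ℚ) : WithTop ℚ) ≤ intToRatTop a ↔ (n : WithTop ℤ) < a := by
  induction a using WithTop.recTopCoe with
  | top => simp [intToRatTop_top]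
  | coe k =>
    rw [intToRatTop_coe, WithTop.coe_le_coe, WithTop.coe_lt_coe]
    refine ⟨fun h => ?_, fun h => ?_⟩
    · by_contra h'
      have : (k : ℚ) ≤ n := by exact_mod_cast not_lt.1 h'
      linarith
    · have : (n + 1 : ℚ) ≤ k := by exact_mod_cast h
      linarith

theorem half_lt_intToRatTop {n : ℤ} {a : WithTop ℤ} :
    ((n + 1 / 2 : ℚ) : WithTop ℚ) < intToRatTop a ↔ (n : WithTop ℤ) < a := by
  induction a using WithTop.recTopCoe with
  | top => simp [intToRatTop_top]
  | coe k =>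
    rw [intToRatTop_coe, WithTop.coe_lt_coe, WithTop.coe_lt_coe]
    refine ⟨fun h => ?_, fun h => ?_⟩
    · by_contra h'
      have : (k : ℚ) ≤ n := by exact_mod_cast not_lt.1 h'
      linarith
    · have : (n + 1 : ℚ) ≤ k := by exact_mod_cast h
      linarith

theorem le_intToRatTop_add_half {n : ℤ} {a : WithTop ℤ} :
    ((n : ℚ) : WithTop ℚ) ≤ intToRatTop a + ((1 / 2 : ℚ) : WithTop ℚ) ↔ (n : WithTop ℤ) ≤ a := by
  induction a using WithTop.recTopCoe with
  | top => simp [intToRatTop_top]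
  | coe k =>
    rw [intToRatTop_coe, ← WithTop.coe_add, WithTop.coe_le_coe, WithTop.coe_le_coe]
    refine ⟨fun h => ?_, fun h => ?_⟩
    · by_contra h'
      have : (k + 1 : ℚ) ≤ n := by exact_mod_cast not_le.1 h'
      linarith
    · have : (n : ℚ) ≤ k := by exact_mod_cast h
      linarith

theorem lt_intToRatTop_add_half {n : ℤ} {a : WithTop ℤ} :
    ((n : ℚ) : WithTop ℚ) < intToRatTop a + ((1 / 2 : ℚ) : WithTop ℚ) ↔ (n : WithTop ℤ) ≤ a := by
  induction a using WithTop.recTopCoe with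
  | top => simp [intToRatTop_top]
  | coe k =>
    rw [intToRatTop_coe, ← WithTop.coe_add, WithTop.coe_lt_coe, WithTop.coe_le_coe]
    refine ⟨fun h => ?_, fun h => ?_⟩
    · by_contra h'
      have : (k + 1 : ℚ) ≤ n := by exact_mod_cast not_le.1 h'
      linarith
    · have : (n : ℚ) ≤ k := by exact_mod_cast h
      linarith

/-- This and the next three statements describe the steps of the filtration around `n` and `n +
1/2`. Passing degree `n` strictly constrains only the first component further, and passing degree `n
+ 1/2` only the second; hence the pieces are copies of `V₁` and `V₂`. -/
theorem intCast_le_hatNorm_iff {n : ℤ} {z : HatU F V₁ V₂} :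
    ((n : ℚ) : WithTop ℚ) ≤ hatNorm z ↔ n ≤ ord z.1 ∧ n ≤ ord z.2 := by
  rw [hatNorm, le_min_iff, le_intToRatTop_iff, le_intToRatTop_add_half]

theorem intCast_lt_hatNorm_iff {n : ℤ} {z : HatU F V₁ V₂} :
    ((n : ℚ) : WithTop ℚ) < hatNorm z ↔ n < ord z.1 ∧ n ≤ ord z.2 := by
  rw [hatNorm, lt_min_iff, lt_intToRatTop_iff, lt_intToRatTop_add_half]

theorem half_le_hatNorm_iff {n : ℤ} {z : HatU F V₁ V₂} :
    ((n + 1 / 2 : ℚ) : WithTop ℚ) ≤ hatNorm z ↔ n < ord z.1 ∧ n ≤ ord z.2 := by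
  rw [hatNorm, le_min_iff, lt_intToRatTop_of_half, WithTop.coe_add,
    WithTop.add_le_add_iff_right WithTop.coe_ne_top, le_intToRatTop_iff]

theorem half_lt_hatNorm_iff {n : ℤ} {z : HatU F V₁ V₂} :
    ((n + 1 / 2 : ℚ) : WithTop ℚ) < hatNorm z ↔ n < ord z.1 ∧ n < ord z.2 := by
  rw [hatNorm, lt_min_iff, half_lt_intToRatTop, WithTop.coe_add,
    WithTop.add_lt_add_iff_right WithTop.coe_ne_top, lt_intToRatTop_iff]

theorem hatNorm_values (z : HatU F V₁ V₂) : hatNorm z = ⊤ ∨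
    (∃ n : ℤ, hatNorm z = ((n : ℚ) : WithTop ℚ)) ∨
      ∃ n : ℤ, hatNorm z = ((n + 1 / 2 : ℚ) : WithTop ℚ) := by
  rcases min_choice (intToRatTop (ord z.1)) (intToRatTop (ord z.2) + ((1 / 2 : ℚ) : WithTop ℚ))
    with h | h
  · rcases eq_top_or_exists_intCast (ord z.1) with h' | ⟨n, h'⟩
    · exact .inl (h.trans h')
    · exact .inr (.inl ⟨n, h.trans h'⟩)
  · rcases eq_top_or_exists_intCast (ord z.2) with h' | ⟨n, h'⟩
    · exact .inl (h.trans (by rw [h', top_add]))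
    · exact .inr (.inr ⟨n, h.trans (by rw [h', WithTop.coe_add])⟩)

theorem intCast_ne_half (m n : ℤ) : (m : ℚ) ≠ n + 1 / 2 := fun h => by
  have : (2 * m : ℚ) = 2 * n + 1 := by linarith
  have : 2 * m = 2 * n + 1 := by exact_mod_cast this
  omega

theorem le_hatNorm_left (x : V₁) (n : ℤ) :
    ((n : ℚ) : WithTop ℚ) ≤ hatNorm ((ext x (tPow F n), 0) : HatU F V₁ V₂) :=
  intCast_le_hatNorm_iff.2 ⟨le_ord_ext_tPow x n, by rw [ord_eq_top_iff.2 rfl]; exact le_top⟩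

theorem le_hatNorm_right (x : V₂) (n : ℤ) :
    ((n + 1 / 2 : ℚ) : WithTop ℚ) ≤ hatNorm ((0, ext x (tPow F n)) : HatU F V₁ V₂) :=
  half_le_hatNorm_iff.2 ⟨by rw [ord_eq_top_iff.2 rfl]; exact WithTop.coe_lt_top _,
    le_ord_ext_tPow x n⟩

end NormCuts

/-! ### The graded module of `Û` -/

section GradedModule

/-- Additive maps from `V ⊗ F[t, t⁻¹]` to a graded module which commute with the action of
`D ⊗ F[t, t⁻¹]` on pure tensors commute with this action. -/
theorem map_smul_of_tmul {F D V M : Type*} [Field F] [DivisionRing D] [Algebra F D]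
    [AddCommGroup V] [Module F V] [Module Dᵐᵒᵖ V] [IsScalarTower F Dᵐᵒᵖ V]
    [AddCommGroup M] [Module (D ⊗[F] LaurentSeries F)ᵐᵒᵖ M] (ν : VNorm (hatVal F D) M)
    (e : ScalarExt F V F[T;T⁻¹] →+ ν.Gr)
    (he : ∀ x n d m, e (ext (op d • x) (LaurentPolynomial.T (n + m))) =
      ν.grSMul (e (ext x (LaurentPolynomial.T n))) (grRingEquiv F D (d ⊗ₜ LaurentPolynomial.T m)))
    (c : D ⊗[F] F[T;T⁻¹]) (z : ScalarExt F V F[T;T⁻¹]) :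
    e (op c • z) = ν.grSMul (e z) (grRingEquiv F D c) := by
  induction z using laurentTensor_induction with
  | zero => rw [smul_zero, map_zero, map_zero, AddMonoidHom.zero_apply]
  | add x y hx hy => rw [smul_add, map_add, hx, hy, map_add, map_add, AddMonoidHom.add_apply]
  | single x n =>
  induction c using tmul_T_induction with
  | zero =>
    have : op (0 : D ⊗[F] F[T;T⁻¹]) • (ext x (LaurentPolynomial.T n) : ScalarExt F V F[T;T⁻¹]) = 0 :=
      zero_smul (D ⊗[F] F[T;T⁻¹])ᵐᵒᵖ
        (ext x (LaurentPolynomial.T n) : ScalarExt F V F[T;T⁻¹])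
    rw [this, map_zero, map_zero, map_zero]
  | add x y hx hy => rw [op_add, add_smul, map_add, hx, hy, map_add, map_add]
  | tmul d m => rw [ext_smul, ← LaurentPolynomial.T_add, he]

variable (F D V₁ V₂ : Type*) [Field F] [DivisionRing D] [Algebra F D]
  [AddCommGroup V₁] [Module F V₁] [Module Dᵐᵒᵖ V₁] [IsScalarTower F Dᵐᵒᵖ V₁]
  [Module.Finite Dᵐᵒᵖ V₁]
  [AddCommGroup V₂] [Module F V₂] [Module Dᵐᵒᵖ V₂] [IsScalarTower F Dᵐᵒᵖ V₂]
  [Module.Finite Dᵐᵒᵖ V₂]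

/-- `∑ₙ xₙ ↦ ∑ₙ (xₙ ⊗ tⁿ, 0)~`. -/
noncomputable def expandLeft : (ℤ →₀ V₁) →+ (hatVNorm F D V₁ V₂).valueFn.Gr :=
  ValueFn.expand _ (fun n => n) (fun n => (AddMonoidHom.inl _ _).comp (extTPow F V₁ n))
    fun n x => le_hatNorm_left x n

/-- `∑ₙ xₙ ↦ ∑ₙ (0, xₙ ⊗ tⁿ)~`. -/
noncomputable def expandRight : (ℤ →₀ V₂) →+ (hatVNorm F D V₁ V₂).valueFn.Gr :=
  ValueFn.expand _ (fun n => n + 1 / 2) (fun n => (AddMonoidHom.inr _ _).comp (extTPow F V₂ n))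
    fun n x => le_hatNorm_right x n

variable {F V₁ V₂} in
theorem expandLeft_single (n : ℤ) (x : V₁) : expandLeft F D V₁ V₂ (Finsupp.single n x) =
    (hatVNorm F D V₁ V₂).valueFn.cls n (ext x (tPow F n), 0) (le_hatNorm_left x n) :=
  ValueFn.expand_single _ _ _ _ n x

variable {F V₁ V₂} in
theorem expandRight_single (n : ℤ) (x : V₂) : expandRight F D V₁ V₂ (Finsupp.single n x) =
    (hatVNorm F D V₁ V₂).valueFn.cls (n + 1 / 2) (0, ext x (tPow F n)) (le_hatNorm_right x n) :=
  ValueFn.expand_single _ _ _ _ n x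

/-- The additive isomorphism of `⨁ₙ V₁ ⊕ ⨁ₙ V₂` and `gr(Û)`. -/
noncomputable def grModuleEquivAux :
    (ℤ →₀ V₁) × (ℤ →₀ V₂) ≃+ (hatVNorm F D V₁ V₂).valueFn.Gr :=
  let w := (hatVNorm F D V₁ V₂).valueFn
  let c₁ : ℤ → HatU F V₁ V₂ →+ V₁ := fun n =>
    (coeffAt (F := F) (V := V₁) n).toAddMonoidHom.comp (AddMonoidHom.fst _ _)
  let c₂ : ℤ → HatU F V₁ V₂ →+ V₂ := fun n =>
    (coeffAt (F := F) (V := V₂) n).toAddMonoidHom.comp (AddMonoidHom.snd _ _)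
  have hc₁ : ∀ (n : ℤ) z, (((n : ℤ) : ℚ) : WithTop ℚ) < w z → c₁ n z = 0 := fun n z h =>
    coeffAt_eq_zero (intCast_lt_hatNorm_iff.1 h).1
  have hc₂ : ∀ (n : ℤ) z, ((n + 1 / 2 : ℚ) : WithTop ℚ) < w z → c₂ n z = 0 := fun n z h =>
    coeffAt_eq_zero (half_lt_hatNorm_iff.1 h).2
  let γ₁ : ℤ → ℚ := fun n => n
  let γ₂ : ℤ → ℚ := fun n => n + 1 / 2
  have hγ₁ : Function.Injective γ₁ := Int.cast_injective
  have hγ₂ : Function.Injective γ₂ := fun m n h => Int.cast_injective (add_right_cancel h)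
  let e := (expandLeft F D V₁ V₂).coprod (expandRight F D V₁ V₂)
  let e' := (w.extract γ₁ c₁ hc₁).prod (w.extract γ₂ c₂ hc₂)
  -- Degrees `n` and `k + 1/2` never coincide, so extracting the components of one kind annihilates
  -- the classes of the other.
  have h₁ : (e'.comp e).comp (AddMonoidHom.inl _ _) = AddMonoidHom.inl _ _ := by
    ext n x : 2
    simp only [AddMonoidHom.comp_apply, AddMonoidHom.coprod_apply, AddMonoidHom.inl_apply,
      AddMonoidHom.prod_apply, Finsupp.singleAddHom_apply, map_zero, add_zero, e, e']
    rw [expandLeft_single]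
    exact Prod.ext
      ((w.extract_cls hγ₁ c₁ hc₁ n _ (le_hatNorm_left x n)).trans
        (congrArg (Finsupp.single n) (coeffAt_ext_tPow (F := F) x n)))
      (w.extract_cls_of_notMem c₂ hc₂ (fun k hk => intCast_ne_half n k hk.symm) _
        (le_hatNorm_left x n))
  have h₂ : (e'.comp e).comp (AddMonoidHom.inr _ _) = AddMonoidHom.inr _ _ := by
    ext n x : 2
    simp only [AddMonoidHom.comp_apply, AddMonoidHom.coprod_apply, AddMonoidHom.inr_apply,
      AddMonoidHom.prod_apply, Finsupp.singleAddHom_apply, map_zero, zero_add, e, e']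
    rw [expandRight_single]
    exact Prod.ext
      (w.extract_cls_of_notMem c₁ hc₁ (fun k hk => intCast_ne_half k n hk) _
        (le_hatNorm_right x n))
      ((w.extract_cls hγ₂ c₂ hc₂ n _ (le_hatNorm_right x n)).trans
        (congrArg (Finsupp.single n) (coeffAt_ext_tPow (F := F) x n)))
  AddMonoidHom.toAddEquiv e e'
    (AddMonoidHom.ext fun z => by
      have h := congrArg₂ (· + ·) (DFunLike.congr_fun h₁ z.1) (DFunLike.congr_fun h₂ z.2)
      simp only [AddMonoidHom.comp_apply, ← map_add] at h
      simpa using h)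
    (by
      refine AddMonoidHom.ext fun z => ?_
      induction z using ValueFn.Gr.induction_on with
      | zero => simp only [map_zero]
      | add x y hx hy => rw [map_add, hx, hy, map_add]
      | cls γ z hz =>
        rw [AddMonoidHom.comp_apply, AddMonoidHom.id_apply]
        simp only [e, e', AddMonoidHom.prod_apply, AddMonoidHom.coprod_apply]
        -- In degree `n` only the leading coefficient of the first component counts: the second
        -- component has order at least `n`, hence value at least `n + 1/2`.
        by_cases h₁ : ∃ n : ℤ, (n : ℚ) = γ
        · obtain ⟨n, rfl⟩ := h₁
          rw [w.extract_cls (γ := γ₁) hγ₁,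
            w.extract_cls_of_notMem (γ := γ₂) _ _ fun k hk => intCast_ne_half n k hk.symm,
            map_zero, add_zero, expandLeft_single]
          refine (w.cls_eq_cls_of_lt_sub hz _ ?_).symm
          obtain ⟨ha, hb⟩ := intCast_le_hatNorm_iff.1 hz
          refine intCast_lt_hatNorm_iff.2 ⟨lt_ord_sub_ext ha, hb.trans_eq (congrArg ord ?_)⟩
          exact (sub_zero z.2).symm
        -- In degree `n + 1/2` the first component already has order greater than `n`, hence value
        -- above `n + 1/2`.
        by_cases h₂ : ∃ n : ℤ, (n + 1 / 2 : ℚ) = γ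
        · obtain ⟨n, rfl⟩ := h₂
          rw [w.extract_cls (γ := γ₂) hγ₂,
            w.extract_cls_of_notMem (γ := γ₁) _ _ fun k hk => intCast_ne_half k n hk,
            map_zero, zero_add, expandRight_single]
          refine (w.cls_eq_cls_of_lt_sub hz _ ?_).symm
          obtain ⟨ha, hb⟩ := half_le_hatNorm_iff.1 hz
          refine half_lt_hatNorm_iff.2 ⟨ha.trans_eq (congrArg ord ?_), lt_ord_sub_ext hb⟩
          exact (sub_zero z.1).symm
        -- The norm has no finite values outside `ℤ` and `ℤ + 1/2`, so these pieces are zero.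
        · rw [w.extract_cls_of_notMem _ _ fun n hn => h₁ ⟨n, hn⟩,
            w.extract_cls_of_notMem _ _ fun n hn => h₂ ⟨n, hn⟩, map_zero, map_zero, add_zero,
            w.cls_eq_zero]
          refine lt_of_le_of_ne hz fun h' => ?_
          rcases hatNorm_values z with hz' | ⟨n, hz'⟩ | ⟨n, hz'⟩
          · exact WithTop.coe_ne_top (h'.trans hz')
          · exact h₁ ⟨n, (WithTop.coe_injective (h'.trans hz')).symm⟩
          · exact h₂ ⟨n, (WithTop.coe_injective (h'.trans hz')).symm⟩)

/-- The additive isomorphism `(V₁ ⊗ F[t, t⁻¹]) ⊕ (V₂ ⊗ F[t, t⁻¹]) ≃ gr(Û)`. -/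
noncomputable def grModuleEquiv :
    ScalarExt F V₁ F[T;T⁻¹] × ScalarExt F V₂ F[T;T⁻¹] ≃+ (hatVNorm F D V₁ V₂).Gr :=
  ((laurentEquiv F V₁).toAddEquiv.prodCongr (laurentEquiv F V₂).toAddEquiv).trans
    (grModuleEquivAux F D V₁ V₂ : (ℤ →₀ V₁) × (ℤ →₀ V₂) ≃+ (hatVNorm F D V₁ V₂).Gr)

variable {F V₁ V₂}

theorem grModuleEquiv_left (x : V₁) (n : ℤ) :
    grModuleEquiv F D V₁ V₂ (ext x (LaurentPolynomial.T n), 0) =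
      (hatVNorm F D V₁ V₂).cls n (ext x (tPow F n), 0) (le_hatNorm_left x n) := by
  change grModuleEquivAux F D V₁ V₂ (laurentEquiv F V₁ (ext x (LaurentPolynomial.T n)),
    laurentEquiv F V₂ 0) = _
  rw [map_zero, laurentEquiv_ext]
  change expandLeft F D V₁ V₂ (Finsupp.single n x) + expandRight F D V₁ V₂ 0 = _
  rw [map_zero, add_zero, expandLeft_single]
  rfl

theorem grModuleEquiv_right (x : V₂) (n : ℤ) :
    grModuleEquiv F D V₁ V₂ (0, ext x (LaurentPolynomial.T n)) =
      (hatVNorm F D V₁ V₂).cls (n + 1 / 2) (0, ext x (tPow F n)) (le_hatNorm_right x n) := by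
  change grModuleEquivAux F D V₁ V₂ (laurentEquiv F V₁ 0,
    laurentEquiv F V₂ (ext x (LaurentPolynomial.T n))) = _
  rw [map_zero, laurentEquiv_ext]
  change expandLeft F D V₁ V₂ 0 + expandRight F D V₁ V₂ (Finsupp.single n x) = _
  rw [map_zero, zero_add, expandRight_single]
  rfl

theorem lead_left (x : V₁) (n : ℤ) : (hatVNorm F D V₁ V₂).lead (ext x (tPow F n), 0) =
    (hatVNorm F D V₁ V₂).cls n (ext x (tPow F n), 0) (le_hatNorm_left x n) := by
  refine ValueFn.lead_eq_cls _ _ ?_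
  by_cases hx : x = 0
  · left
    subst hx
    exact hatNorm_eq_top_iff.2 (Prod.ext (zero_ext _) rfl)
  · exact .inr (hatNorm_ext_left hx n)

theorem lead_right (x : V₂) (n : ℤ) : (hatVNorm F D V₁ V₂).lead (0, ext x (tPow F n)) =
    (hatVNorm F D V₁ V₂).cls (n + 1 / 2) (0, ext x (tPow F n)) (le_hatNorm_right x n) := by
  refine ValueFn.lead_eq_cls _ _ ?_
  by_cases hx : x = 0
  · left
    subst hx
    exact hatNorm_eq_top_iff.2 (Prod.ext rfl (zero_ext _))
  · exact .inr (hatNorm_ext_right hx n)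

variable {D}

/-- On monomials both sides are the class of `x d ⊗ t^(n+m)`; the degree of a scalar monomial is an
integer, so the offset `1/2` on the second summand is preserved. -/
theorem grModuleEquiv_smul (c : D ⊗[F] F[T;T⁻¹])
    (z : ScalarExt F V₁ F[T;T⁻¹] × ScalarExt F V₂ F[T;T⁻¹]) :
    grModuleEquiv F D V₁ V₂ (op c • z) =
      op (grRingEquiv F D c) • grModuleEquiv F D V₁ V₂ z := by
  change grModuleEquiv F D V₁ V₂ (op c • z.1, op c • z.2) =
    (hatVNorm F D V₁ V₂).grSMul (grModuleEquiv F D V₁ V₂ (z.1, z.2)) (grRingEquiv F D c)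
  let e := (grModuleEquiv F D V₁ V₂).toAddMonoidHom
  have h : ∀ x y, grModuleEquiv F D V₁ V₂ (x, y) =
      e.comp (AddMonoidHom.inl _ _) x + e.comp (AddMonoidHom.inr _ _) y := fun x y => by
    rw [AddMonoidHom.comp_apply, AddMonoidHom.comp_apply, ← map_add]
    simp [e]
  rw [h, h, map_add, AddMonoidHom.add_apply]
  congr 1
  · refine map_smul_of_tmul _ _ (fun x n d m => ?_) c z.1
    change grModuleEquiv F D V₁ V₂ (ext (op d • x) (LaurentPolynomial.T (n + m)), 0) =
      (hatVNorm F D V₁ V₂).grSMul (grModuleEquiv F D V₁ V₂ (ext x (LaurentPolynomial.T n), 0)) _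
    rw [grModuleEquiv_left, grModuleEquiv_left, grRingEquiv_tmul]
    refine Eq.trans ?_ (VNorm.grSMul_cls _ _ _).symm
    refine VNorm.cls_congr _ (Int.cast_add n m) (Prod.ext ?_ (smul_zero _).symm) _
    exact ((ext_smul _ _ _ _).trans (by rw [tPow_mul_tPow])).symm
  · refine map_smul_of_tmul _ _ (fun x n d m => ?_) c z.2
    change grModuleEquiv F D V₁ V₂ (0, ext (op d • x) (LaurentPolynomial.T (n + m))) =
      (hatVNorm F D V₁ V₂).grSMul (grModuleEquiv F D V₁ V₂ (0, ext x (LaurentPolynomial.T n))) _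
    rw [grModuleEquiv_right, grModuleEquiv_right, grRingEquiv_tmul]
    refine Eq.trans ?_ (VNorm.grSMul_cls _ _ _).symm
    refine VNorm.cls_congr _ (by push_cast; ring) (Prod.ext (smul_zero _).symm ?_) _
    exact ((ext_smul _ _ _ _).trans (by rw [tPow_mul_tPow])).symm

end GradedModule

/-! ### The action of a similitude on the graded module -/

section Similitude

variable {F D : Type*} [Field F] [DivisionRing D] [Algebra F D] {ρ : Involution F D}
  {V₁ V₂ : Type*}
  [AddCommGroup V₁] [Module F V₁] [Module Dᵐᵒᵖ V₁] [IsScalarTower F Dᵐᵒᵖ V₁]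
  [AddCommGroup V₂] [Module F V₂] [Module Dᵐᵒᵖ V₂] [IsScalarTower F Dᵐᵒᵖ V₂]
  (h₁ : HermForm ρ 1 V₁) (h₂ : HermForm ρ (-1) V₂)

theorem conjForm_apply (x y : HatU F V₁ V₂) : conjForm h₁ h₂ x y =
    iotaD F D ((hatForm h₁ h₂).bilin (iotaU F V₁ V₂ x) (iotaU F V₁ V₂ y)) := rfl

theorem iotaU_fst (x : HatU F V₁ V₂) : (iotaU F V₁ V₂ x).1 =
    extMap LinearMap.id (laurentIota F).toLinearMap x.1 := rfl

theorem iotaU_snd (x : HatU F V₁ V₂) : (iotaU F V₁ V₂ x).2 =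
    extMap LinearMap.id (laurentIota F).toLinearMap x.2 := rfl

theorem one_le_of_pos_withTop {m : WithTop ℤ} (h : (0 : ℤ) < m) : ((1 : ℤ) : WithTop ℤ) ≤ m := by
  induction m with
  | top => exact le_top
  | coe m => exact WithTop.coe_le_coe.2 (WithTop.coe_lt_coe.1 h)

/-- The summand `t ĥ₂` starts in degree `1` at the earliest and does not contribute. -/
theorem coeffAt_zero_hatForm {x y : HatU F V₁ V₂} (hx : (0 : ℤ) ≤ ord x.1 ∧ (0 : ℤ) ≤ ord x.2)
    (hy : (0 : ℤ) ≤ ord y.1 ∧ (0 : ℤ) ≤ ord y.2) :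
    coeffAt 0 (asExt F D ((hatForm h₁ h₂).bilin x y)) =
      h₁.bilin (coeffAt 0 x.1) (coeffAt 0 y.1) := by
  have h1 := (h₁.hat_lowest hx.1 hy.1).2
  have h2 := (h₂.hat_lowest hx.2 hy.2).1
  rw [add_zero] at h1 h2
  rw [zpow_zero, one_smul] at h1
  rw [hatForm_apply, map_add, map_add, coeffAt_tPow_mul, h1,
    le_ord_iff.1 h2 _ (WithTop.coe_lt_coe.2 (by norm_num)), add_zero]

/-- First components of positive order make `ĥ₁` start in degree `2`, so the coefficient of `t`
comes from `t ĥ₂` alone. -/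
theorem coeffAt_one_hatForm {x y : HatU F V₁ V₂} (hx : (0 : ℤ) < ord x.1 ∧ (0 : ℤ) ≤ ord x.2)
    (hy : (0 : ℤ) < ord y.1 ∧ (0 : ℤ) ≤ ord y.2) :
    coeffAt 1 (asExt F D ((hatForm h₁ h₂).bilin x y)) =
      h₂.bilin (coeffAt 0 x.2) (coeffAt 0 y.2) := by
  have hx1 : ((1 : ℤ) : WithTop ℤ) ≤ ord x.1 := one_le_of_pos_withTop hx.1
  have hy1 : ((1 : ℤ) : WithTop ℤ) ≤ ord y.1 := one_le_of_pos_withTop hy.1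
  have h1 := (h₁.hat_lowest hx1 hy1).1
  have h2 := (h₂.hat_lowest hx.2 hy.2).2
  rw [add_zero, zpow_zero, one_smul] at h2
  rw [hatForm_apply, map_add, map_add, coeffAt_tPow_mul, sub_self, h2,
    le_ord_iff.1 h1 _ (WithTop.coe_lt_coe.2 (by norm_num)), zero_add]

theorem coeffAt_zero_conjForm {x y : HatU F V₁ V₂} (hx : (0 : ℤ) ≤ ord x.1 ∧ (0 : ℤ) ≤ ord x.2)
    (hy : (0 : ℤ) ≤ ord y.1 ∧ (0 : ℤ) ≤ ord y.2) :
    coeffAt 0 (asExt F D (conjForm h₁ h₂ x y)) =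
      h₁.bilin (coeffAt 0 x.1) (coeffAt 0 y.1) := by
  rw [conjForm_apply, coeffAt_iotaD, coeffAt_zero_hatForm]
  · simp only [iotaU_fst, coeffAt_extMap_iota, zpow_zero, one_smul]
  · rwa [iotaU_fst, iotaU_snd, ord_extMap_iota, ord_extMap_iota]
  · rwa [iotaU_fst, iotaU_snd, ord_extMap_iota, ord_extMap_iota]

/-- The sign is that of `ι(t) = -t`; it is the source of the multiplier `-a` on `V₂`. -/
theorem coeffAt_one_conjForm {x y : HatU F V₁ V₂} (hx : (0 : ℤ) < ord x.1 ∧ (0 : ℤ) ≤ ord x.2)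
    (hy : (0 : ℤ) < ord y.1 ∧ (0 : ℤ) ≤ ord y.2) :
    coeffAt 1 (asExt F D (conjForm h₁ h₂ x y)) =
      -h₂.bilin (coeffAt 0 x.2) (coeffAt 0 y.2) := by
  rw [conjForm_apply, coeffAt_iotaD, coeffAt_one_hatForm]
  · simp only [iotaU_snd, coeffAt_extMap_iota, zpow_zero, one_smul, zpow_one, neg_smul]
  · rwa [iotaU_fst, iotaU_snd, ord_extMap_iota, ord_extMap_iota]
  · rwa [iotaU_fst, iotaU_snd, ord_extMap_iota, ord_extMap_iota]

theorem hatVal_const {a : F} (ha : a ≠ 0) :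
    hatVal F D ((1 : D) ⊗ₜ[F] algebraMap F (LaurentSeries F) a) = 0 := by
  have h0 : (1 : D) ⊗ₜ[F] algebraMap F (LaurentSeries F) a =
      (algebraMap F D a) ⊗ₜ[F] tPow F 0 := by
    rw [Algebra.algebraMap_eq_smul_one, Algebra.algebraMap_eq_smul_one, TensorProduct.tmul_smul,
      TensorProduct.smul_tmul', tPow_zero]
  have h1 : ord (asExt F D ((1 : D) ⊗ₜ[F] algebraMap F (LaurentSeries F) a)) =
      ((0 : ℤ) : WithTop ℤ) := by
    rw [h0, asExt_tmul, ord_eq_iff, coeffAt_ext_tPow]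
    exact ⟨le_ord_ext_tPow _ _, (map_ne_zero_iff _ (algebraMap F D).injective).2 ha⟩
  rw [hatVal_eq, h1]
  exact map_zero intToRatTop

variable {h₁ h₂} {g : HatU F V₁ V₂ →ₗ[(D ⊗[F] LaurentSeries F)ᵐᵒᵖ] HatU F V₁ V₂} {a : F}

/-- Similitudes with constant multiplier preserve the norm. -/
theorem hatNorm_similitude (hh₁ : h₁.Anisotropic) (hh₂ : h₂.Anisotropic) (ha : a ≠ 0)
    (hg : HasHatMultiplier h₁ h₂ g (algebraMap F (LaurentSeries F) a)) (x : HatU F V₁ V₂) :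
    hatNorm (g x) = hatNorm x := by
  -- Conjugation preserves both the norm and the valuation, so the norm of `g x` is half the
  -- valuation of `ĥ^ι(g x, g x) = a ĥ(x, x)`, and `a` has valuation `0`.
  rw [← hatNorm_iotaU (g x), ← half_hatVal_hatForm hh₁ hh₂, ← half_hatVal_hatForm hh₁ hh₂,
    ← hatVal_iotaD, ← conjForm_apply, hg x x, AddValuation.map_mul, hatVal_const ha, zero_add]

theorem ext_one_smul_left (d : Dᵐᵒᵖ) (x : V₁) :
    ((ext (d • x) (tPow F 0), 0) : HatU F V₁ V₂) =
      op (d.unop ⊗ₜ[F] (1 : LaurentSeries F)) • ((ext x (tPow F 0), 0) : HatU F V₁ V₂) :=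
  Prod.ext ((ext_smul _ _ _ _).trans (by rw [mul_one, op_unop])).symm (smul_zero _).symm

theorem ext_one_smul_right (d : Dᵐᵒᵖ) (x : V₂) :
    ((0, ext (d • x) (tPow F 0)) : HatU F V₁ V₂) =
      op (d.unop ⊗ₜ[F] (1 : LaurentSeries F)) • ((0, ext x (tPow F 0)) : HatU F V₁ V₂) :=
  Prod.ext (smul_zero _).symm ((ext_smul _ _ _ _).trans (by rw [mul_one, op_unop])).symm

theorem ext_add_left (x y : V₁) (f : LaurentSeries F) :
    ((ext (x + y) f, 0) : HatU F V₁ V₂) = (ext x f, 0) + (ext y f, 0) :=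
  Prod.ext (add_ext x y f) (add_zero _).symm

theorem ext_add_right (x y : V₂) (f : LaurentSeries F) :
    ((0, ext (x + y) f) : HatU F V₁ V₂) = (0, ext x f) + (0, ext y f) :=
  Prod.ext (add_zero _).symm (add_ext x y f)

variable (g)

/-- The endomorphism of `V₁` given by the constant terms of `g`. -/
noncomputable def residueLeft : V₁ →ₗ[Dᵐᵒᵖ] V₁ where
  toFun x := coeffAt 0 (g (ext x (tPow F 0), 0)).1
  map_add' x y := by rw [ext_add_left, map_add, Prod.fst_add, map_add]
  map_smul' d x := by
    rw [ext_one_smul_left, map_smul, Prod.smul_fst, coeffAt_const_smul, op_unop, RingHom.id_apply]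

/-- The endomorphism of `V₂` given by the constant terms of `g`. -/
noncomputable def residueRight : V₂ →ₗ[Dᵐᵒᵖ] V₂ where
  toFun x := coeffAt 0 (g (0, ext x (tPow F 0))).2
  map_add' x y := by rw [ext_add_right, map_add, Prod.snd_add, map_add]
  map_smul' d x := by
    rw [ext_one_smul_right, map_smul, Prod.smul_snd, coeffAt_const_smul, op_unop,
      RingHom.id_apply]

variable {g}

/-- Norm preservation keeps `g(x ⊗ 1, 0)` in the filtration step of degree `0`, where the
coefficient of `t⁰` of either form is `h₁` on constant terms. -/
theorem residueLeft_multiplier (hν : ∀ x, hatNorm (g x) = hatNorm x)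
    (hg : HasHatMultiplier h₁ h₂ g (algebraMap F (LaurentSeries F) a)) :
    HasMultiplier h₁.bilin h₁.bilin (residueLeft g) (algebraMap F D a) := by
  have h : ∀ x : V₁, (0 : ℤ) ≤ ord ((ext x (tPow F 0), 0) : HatU F V₁ V₂).1 ∧
      (0 : ℤ) ≤ ord ((ext x (tPow F 0), 0) : HatU F V₁ V₂).2 := fun x =>
    intCast_le_hatNorm_iff.1 (le_hatNorm_left x 0)
  have h' : ∀ x : V₁, (0 : ℤ) ≤ ord (g (ext x (tPow F 0), 0)).1 ∧
      (0 : ℤ) ≤ ord (g (ext x (tPow F 0), 0)).2 := fun x =>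
    intCast_le_hatNorm_iff.1 ((le_hatNorm_left x 0).trans_eq (hν _).symm)
  intro x y
  have := congrArg (fun z => coeffAt 0 (asExt F D z))
    (hg (ext x (tPow F 0), 0) (ext y (tPow F 0), 0))
  rw [coeffAt_zero_conjForm h₁ h₂ (h' x) (h' y), coeffAt_const_mul,
    coeffAt_zero_hatForm h₁ h₂ (h x) (h y), coeffAt_ext_tPow, coeffAt_ext_tPow] at this
  exact this

/-- The images of `(0, x ⊗ 1)` have norm at least `1/2`, so their first components have positive
order and the coefficients of `t¹` can be compared. The sign in `ĥ^ι` is moved to the multiplier. -/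
theorem residueRight_multiplier (hν : ∀ x, hatNorm (g x) = hatNorm x)
    (hg : HasHatMultiplier h₁ h₂ g (algebraMap F (LaurentSeries F) a)) :
    HasMultiplier h₂.bilin h₂.bilin (residueRight g) (algebraMap F D (-a)) := by
  have h : ∀ x : V₂, (0 : ℤ) < ord ((0, ext x (tPow F 0)) : HatU F V₁ V₂).1 ∧
      (0 : ℤ) ≤ ord ((0, ext x (tPow F 0)) : HatU F V₁ V₂).2 := fun x =>
    half_le_hatNorm_iff.1 (le_hatNorm_right x 0)
  have h' : ∀ x : V₂, (0 : ℤ) < ord (g (0, ext x (tPow F 0))).1 ∧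
      (0 : ℤ) ≤ ord (g (0, ext x (tPow F 0))).2 := fun x =>
    half_le_hatNorm_iff.1 ((le_hatNorm_right x 0).trans_eq (hν _).symm)
  intro x y
  have := congrArg (fun z => coeffAt 1 (asExt F D z))
    (hg (0, ext x (tPow F 0)) (0, ext y (tPow F 0)))
  rw [coeffAt_one_conjForm h₁ h₂ (h' x) (h' y), coeffAt_const_mul,
    coeffAt_one_hatForm h₁ h₂ (h x) (h y), coeffAt_ext_tPow, coeffAt_ext_tPow, neg_eq_iff_eq_neg,
    ← neg_mul, ← map_neg] at this
  exact this

/-- The second component of `g(x ⊗ 1, 0)` has nonnegative order, hence value at least `1/2`, and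
disappears in degree `0`. -/
theorem hatNorm_sub_residueLeft (hν : ∀ x, hatNorm (g x) = hatNorm x) (x : V₁) :
    (((0 : ℤ) : ℚ) : WithTop ℚ) <
      hatNorm (g (ext x (tPow F 0), 0) - (ext (residueLeft g x) (tPow F 0), 0)) := by
  obtain ⟨h1, h2⟩ := intCast_le_hatNorm_iff.1 ((le_hatNorm_left (V₂ := V₂) x 0).trans_eq (hν _).symm)
  exact intCast_lt_hatNorm_iff.2 ⟨lt_ord_sub_ext h1, h2.trans_eq (congrArg ord (sub_zero _).symm)⟩

theorem hatNorm_sub_residueRight (hν : ∀ x, hatNorm (g x) = hatNorm x) (x : V₂) :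
    ((((0 : ℤ) : ℚ) + 1 / 2 : ℚ) : WithTop ℚ) <
      hatNorm (g (0, ext x (tPow F 0)) - (0, ext (residueRight g x) (tPow F 0))) := by
  obtain ⟨h1, h2⟩ := half_le_hatNorm_iff.1 ((le_hatNorm_right (V₁ := V₁) x 0).trans_eq (hν _).symm)
  exact half_lt_hatNorm_iff.2 ⟨h1.trans_eq (congrArg ord (sub_zero _).symm), lt_ord_sub_ext h2⟩

theorem ext_tPow_left (x : V₁) (n : ℤ) : ((ext x (tPow F n), 0) : HatU F V₁ V₂) =
    op ((1 : D) ⊗ₜ[F] tPow F n) • ((ext x (tPow F 0), 0) : HatU F V₁ V₂) :=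
  Prod.ext ((ext_smul _ _ _ _).trans (by rw [tPow_mul_tPow, op_one, one_smul, zero_add])).symm
    (smul_zero _).symm

theorem ext_tPow_right (x : V₂) (n : ℤ) : ((0, ext x (tPow F n)) : HatU F V₁ V₂) =
    op ((1 : D) ⊗ₜ[F] tPow F n) • ((0, ext x (tPow F 0)) : HatU F V₁ V₂) :=
  Prod.ext (smul_zero _).symm
    ((ext_smul _ _ _ _).trans (by rw [tPow_mul_tPow, op_one, one_smul, zero_add])).symm

/-- Transports the congruences in degrees `0` and `1/2` to all degrees by translation with `tⁿ`. -/
theorem lt_hatNorm_tPow_smul_sub {γ : ℚ} {x y : HatU F V₁ V₂} (h : (γ : WithTop ℚ) < hatNorm (x - y))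
    (n : ℤ) : ((n + γ : ℚ) : WithTop ℚ) <
      hatNorm (op ((1 : D) ⊗ₜ[F] tPow F n) • x - op ((1 : D) ⊗ₜ[F] tPow F n) • y) := by
  have e : op ((1 : D) ⊗ₜ[F] tPow F n) • x - op ((1 : D) ⊗ₜ[F] tPow F n) • y =
      op ((1 : D) ⊗ₜ[F] tPow F n) • (x - y) :=
    Prod.ext (smul_sub _ x.1 y.1).symm (smul_sub _ x.2 y.2).symm
  rw [e, hatNorm_smul, hatVal_tPow, add_comm, WithTop.coe_add]
  exact WithTop.add_lt_add_right WithTop.coe_ne_top h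

variable [Module.Finite Dᵐᵒᵖ V₁] [Module.Finite Dᵐᵒᵖ V₂]

/-- Since `g` commutes with `tⁿ`, the congruence between `g(x ⊗ 1, 0)` and `(g₁ x ⊗ 1, 0)` persists
after multiplication by `tⁿ`. -/
theorem grMap_left (hν : ∀ x, hatVNorm F D V₁ V₂ (g x) = hatVNorm F D V₁ V₂ x) (x : V₁) (n : ℤ) :
    (hatVNorm F D V₁ V₂).grMap g hν
      (grModuleEquiv F D V₁ V₂ (ext x (LaurentPolynomial.T n), 0)) =
      grModuleEquiv F D V₁ V₂ (ext (residueLeft g x) (LaurentPolynomial.T n), 0) := by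
  rw [grModuleEquiv_left, grModuleEquiv_left]
  refine ((hatVNorm F D V₁ V₂).grMapHom_cls g hν _).trans ?_
  refine ValueFn.cls_eq_cls_of_lt_sub _ _ _ ?_
  have := lt_hatNorm_tPow_smul_sub (D := D) (hatNorm_sub_residueLeft hν x) n
  rw [Int.cast_zero, add_zero, ← map_smul, ← ext_tPow_left, ← ext_tPow_left] at this
  exact this

theorem grMap_right (hν : ∀ x, hatVNorm F D V₁ V₂ (g x) = hatVNorm F D V₁ V₂ x) (x : V₂) (n : ℤ) :
    (hatVNorm F D V₁ V₂).grMap g hν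
      (grModuleEquiv F D V₁ V₂ (0, ext x (LaurentPolynomial.T n))) =
      grModuleEquiv F D V₁ V₂ (0, ext (residueRight g x) (LaurentPolynomial.T n)) := by
  rw [grModuleEquiv_right, grModuleEquiv_right]
  refine ((hatVNorm F D V₁ V₂).grMapHom_cls g hν _).trans ?_
  refine ValueFn.cls_eq_cls_of_lt_sub _ _ _ ?_
  have := lt_hatNorm_tPow_smul_sub (D := D) (hatNorm_sub_residueRight hν x) n
  rw [Int.cast_zero, zero_add, ← map_smul, ← ext_tPow_right, ← ext_tPow_right] at this
  exact this

theorem grMap_eq (hν : ∀ x, hatVNorm F D V₁ V₂ (g x) = hatVNorm F D V₁ V₂ x)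
    (z : ScalarExt F V₁ F[T;T⁻¹] × ScalarExt F V₂ F[T;T⁻¹]) :
    (hatVNorm F D V₁ V₂).grMap g hν (grModuleEquiv F D V₁ V₂ z) =
      grModuleEquiv F D V₁ V₂
        (extMap ((residueLeft g).restrictScalars F) LinearMap.id z.1,
          extMap ((residueRight g).restrictScalars F) LinearMap.id z.2) := by
  have hl : ∀ x : ScalarExt F V₁ F[T;T⁻¹],
      (hatVNorm F D V₁ V₂).grMap g hν (grModuleEquiv F D V₁ V₂ (x, 0)) = grModuleEquiv F D V₁ V₂
        (extMap ((residueLeft g).restrictScalars F) LinearMap.id x, 0) := fun x => by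
    induction x using laurentTensor_induction with
    | zero => rw [map_zero, Prod.mk_zero_zero, map_zero, map_zero]
    | single x n => exact grMap_left hν x n
    | add x y hx hy =>
      rw [map_add, ← add_zero (0 : ScalarExt F V₂ F[T;T⁻¹]), ← Prod.mk_add_mk, ← Prod.mk_add_mk,
        map_add, map_add, map_add, hx, hy]
  have hr : ∀ x : ScalarExt F V₂ F[T;T⁻¹],
      (hatVNorm F D V₁ V₂).grMap g hν (grModuleEquiv F D V₁ V₂ (0, x)) = grModuleEquiv F D V₁ V₂
        (0, extMap ((residueRight g).restrictScalars F) LinearMap.id x) := fun x => by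
    induction x using laurentTensor_induction with
    | zero => rw [map_zero, Prod.mk_zero_zero, map_zero, map_zero]
    | single x n => exact grMap_right hν x n
    | add x y hx hy =>
      rw [map_add, ← add_zero (0 : ScalarExt F V₁ F[T;T⁻¹]), ← Prod.mk_add_mk, ← Prod.mk_add_mk,
        map_add, map_add, map_add, hx, hy]
  have hz : z = (z.1, 0) + (0, z.2) := by simp
  conv_lhs => rw [hz]
  rw [map_add, map_add, hl, hr, ← map_add, Prod.mk_add_mk, add_zero, zero_add]

end Similitude

end GenHerm

theorem mainTheorem12 {F D : Type*} [Field F] (hF : (2 : F) ≠ 0)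
    [DivisionRing D] [Algebra F D] [Algebra.IsCentral F D] [FiniteDimensional F D]
    (ρ : Involution F D) {V₁ V₂ : Type*}
    [AddCommGroup V₁] [Module F V₁] [Module Dᵐᵒᵖ V₁] [IsScalarTower F Dᵐᵒᵖ V₁]
    [Module.Finite Dᵐᵒᵖ V₁]
    [AddCommGroup V₂] [Module F V₂] [Module Dᵐᵒᵖ V₂] [IsScalarTower F Dᵐᵒᵖ V₂]
    [Module.Finite Dᵐᵒᵖ V₂]
    (h₁ : HermForm ρ 1 V₁) (h₂ : HermForm ρ (-1) V₂)
    (hh₁ : h₁.Anisotropic) (hh₂ : h₂.Anisotropic) :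
    -- every similitude is a scalar multiple of one with multiplier in `Fˣ`
    (∀ g : HatU F V₁ V₂ →ₗ[(D ⊗[F] LaurentSeries F)ᵐᵒᵖ] HatU F V₁ V₂,
      IsHatSimilitude h₁ h₂ g →
        ∃ (c : LaurentSeries F)
          (g' : HatU F V₁ V₂ →ₗ[(D ⊗[F] LaurentSeries F)ᵐᵒᵖ] HatU F V₁ V₂) (a : F),
          c ≠ 0 ∧ a ≠ 0 ∧ IsHatSimilitude h₁ h₂ g' ∧
          HasHatMultiplier h₁ h₂ g' (algebraMap F (LaurentSeries F) a) ∧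
          ∀ x, g x = MulOpposite.op ((1 : D) ⊗ₜ[F] c) • g' x) ∧
    -- `ν(x) = ½ v(ĥ(x, x))` is a norm on `Û`
    ∃ ν : VNorm (hatVal F D) (HatU F V₁ V₂),
      (∀ x, ν x = WithTop.map (fun q : ℚ => q / 2) (hatVal F D ((hatForm h₁ h₂).bilin x x))) ∧
      -- the graded ring of `D̂` is `D ⊗ F[t̃, t̃⁻¹]`
      ∃ Φ : D ⊗[F] F[T;T⁻¹] ≃+* GrRing (hatVal F D),
        (∀ (d : D) (n : ℤ), Φ (d ⊗ₜ LaurentPolynomial.T n) =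
          GrRing.lead (hatVal F D) (d ⊗ₜ tPow F n)) ∧
      -- the graded module of `Û` is `(V₁ ⊗ F[t̃, t̃⁻¹]) ⊕ (V₂ ⊗ F[t̃, t̃⁻¹])`
      ∃ E : ScalarExt F V₁ F[T;T⁻¹] × ScalarExt F V₂ F[T;T⁻¹] ≃+ ν.Gr,
        (∀ (c : D ⊗[F] F[T;T⁻¹]) (z : ScalarExt F V₁ F[T;T⁻¹] × ScalarExt F V₂ F[T;T⁻¹]),
          E (MulOpposite.op c • z) = MulOpposite.op (Φ c) • E z) ∧
        (∀ (x : V₁) (n : ℤ),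
          E (ext x (LaurentPolynomial.T n), 0) = ν.lead (ext x (tPow F n), 0)) ∧
        (∀ (x : V₂) (n : ℤ),
          E (0, ext x (LaurentPolynomial.T n)) = ν.lead (0, ext x (tPow F n))) ∧
        -- a similitude with multiplier `a ∈ Fˣ` induces `g₁ ⊕ g₂`
        ∀ (g' : HatU F V₁ V₂ →ₗ[(D ⊗[F] LaurentSeries F)ᵐᵒᵖ] HatU F V₁ V₂) (a : F), a ≠ 0 →
          HasHatMultiplier h₁ h₂ g' (algebraMap F (LaurentSeries F) a) →
          ∃ (hν : ∀ x, ν (g' x) = ν x) (g₁ : V₁ →ₗ[Dᵐᵒᵖ] V₁) (g₂ : V₂ →ₗ[Dᵐᵒᵖ] V₂),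
            HasMultiplier h₁.bilin h₁.bilin g₁ (algebraMap F D a) ∧
            HasMultiplier h₂.bilin h₂.bilin g₂ (algebraMap F D (-a)) ∧
            ∀ z, ν.grMap g' hν (E z) =
              E (extMap (g₁.restrictScalars F) LinearMap.id z.1,
                extMap (g₂.restrictScalars F) LinearMap.id z.2) := by
  -- The norm is supplied by the explicit formula, for which the axioms are checked coordinatewise;
  -- anisotropy enters when it is identified with half the valuation of `ĥ(x, x)`.
  refine ⟨exists_constant_multiplier hF h₁ h₂, hatVNorm F D V₁ V₂,
    fun x => (half_hatVal_hatForm hh₁ hh₂ x).symm, grRingEquiv F D,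
    fun d n => (grRingEquiv_tmul F D d n).trans (lead_tmul_tPow F D d n).symm,
    grModuleEquiv F D V₁ V₂, grModuleEquiv_smul,
    fun x n => (grModuleEquiv_left D x n).trans (lead_left D x n).symm,
    fun x n => (grModuleEquiv_right D x n).trans (lead_right D x n).symm,
    fun g' a ha hg => ?_⟩
  have hν := hatNorm_similitude hh₁ hh₂ ha hg
  exact ⟨hν, residueLeft g', residueRight g', residueLeft_multiplier hν hg,
    residueRight_multiplier hν hg, grMap_eq hν⟩
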